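/- **Setting.** Let $0<\beta<1$, let $L_S,L_P,k\ge 1$ be integers with $L_S=1/\beta$ (rounded to an integer, up or down, if $1/\beta$ is not one), and let $n=kL_S+(k-1)L_P$. Let $X$ be a string of $n$ independent uniform bits, written as a concatenation $X=S_1,P_1,S_2,P_2,\dots,S_{k-1},P_{k-1},S_k$ with $|S_i|=L_S$ (segments) and $|P_i|=L_P$ (pivots); let $\check p_i$ and $\hat p_i$ be the indices in $X$ of the first and the last bit of $P_i$. Let the deletion pattern $D\in\{0,1\}^n$ be independent of $X$ and have independent entries with $\Pr\{D(j)=1\}=\beta$, and let $Y$ be obtained from $X$ by deleting the bits $X(j)$ with $D(j)=1$. Let $f_D(j)$ be the number of indices $j'\le j$ with $D(j')=0$. A *match* of $P_i$ is a copy of $P_i$ as a block of $L_P$ consecutive bits of $Y$. It is *correct* if either no bit of $P_i$ is deleted and the match begins at $f_D(\check p_i)$ (and so ends at $f_D(\hat p_i)$), or exactly one bit of $P_i$ is deleted and the match begins at $f_D(\check p_i)$ or ends at $f_D(\hat p_i)$; all other matches are incorrect. The matching graph $G$ has layers $\Lambda_0=\{s\}$, $\Lambda_k=\{t\}$ and,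 for $1\le i\le k-1$, $\Lambda_i$ the set of all matches of $P_i$ in $Y$. Let $\check v$ and $\hat v$ be the first and the last index in $Y$ of the match $v$, and let $\hat s=0$, $\check t=|Y|+1$. For $i<j$ there is a (directed) edge from $u\in\Lambda_i$ to $v\in\Lambda_j$ if and only if $$-1\le \check v-\hat u-1\le (j-i-1)L_P+(j-i)L_S .$$ A vertex is *good* if it is a correct match. Put $R=1-L_P\beta+2\beta$; $\log$ is to base $2$. **Theorem.** For every constant $C$ and every function $\varepsilon_1(\beta)=o(\beta)$ (as $\beta\to0^+$) there are a function $\varepsilon_2(\beta)=o(\beta)$ and a $\beta_0>0$ such that the following holds for all $0<\beta<\beta_0$ and all $L_S$ as above and $L_P$ with $11+2\log\frac1\beta\le L_P\le C\log\frac1\beta$. There are $c>0$ and $N$ such that for all $n\ge N$ of the form $n=kL_S+(k-1)L_P$, with probability at least $1-2^{-cn}$, every path from $s$ to $t$ in $G$ whose number of vertices differs from $Rk$ by at most $\varepsilon_1(\beta)k$ contains at least $Rk-\beta k-\varepsilon_2(\beta)k$ good vertices. -/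

import Mathlib

open MeasureTheory ProbabilityTheory Filter Topology Asymptotics

namespace PivotMatching

/-! ### The deletion channel -/

/-- The `i`-th entry `Z(i)` of a string, with indices starting at `1`;
`none` if `i` is not an index of `Z`. -/
def bit (Z : List Bool) : ℕ → Option Bool
  | 0 => none
  | i + 1 => Z[i]?

/-- The output of the deletion channel: the entries of `X` that the deletion pattern `D` does not
delete, in their order. Position `i : Fin n` carries the index `i + 1`, and `D i = true` means that
the bit at this position is deleted. -/
def output {n : ℕ} (X D : Fin n → Bool) : List Bool :=
  ((List.finRange n).filter fun i => !(D i)).map X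

/-- The index map `f_D` of a deletion pattern: the number of undeleted indices in `{1, …, i}`.
If `i` is undeleted this is `i - ∑_{j < i} D(j)`; if `i` is deleted it is the value
at the largest undeleted index below `i` (and `0` if there is none). -/
def indexMap {n : ℕ} (D : Fin n → Bool) (i : ℕ) : ℕ :=
  (Finset.univ.filter fun j : Fin n => j.val + 1 ≤ i ∧ D j = false).card

/-! ### Pivots

The input is `X = S₁, P₁, S₂, P₂, …, S_{k-1}, P_{k-1}, S_k` with `|S_i| = LS` and `|P_i| = LP`. -/

/-- The index in `X` of the first bit of the pivot `P_i` (for `i ≥ 1`). -/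
def pivotFirst (LS LP i : ℕ) : ℕ := i * LS + (i - 1) * LP + 1

/-- The index in `X` of the last bit of the pivot `P_i` (for `i ≥ 1`). -/
def pivotLast (LS LP i : ℕ) : ℕ := i * LS + i * LP

/-- The number of deletions within the pivot `P_i`. -/
def pivotDeletions (LS LP : ℕ) {n : ℕ} (D : Fin n → Bool) (i : ℕ) : ℕ :=
  (Finset.univ.filter fun j : Fin n =>
    pivotFirst LS LP i ≤ j.val + 1 ∧ j.val + 1 ≤ pivotLast LS LP i ∧ D j = true).card

/-- A copy (match) of the pivot `P_i` occupies the indices `v, …, v + LP - 1` of `Y`. -/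
def IsMatch (LS LP : ℕ) {n : ℕ} (X D : Fin n → Bool) (i v : ℕ) : Prop :=
  1 ≤ v ∧ v + LP ≤ (output X D).length + 1 ∧
    ∀ r < LP, bit (output X D) (v + r) = bit (List.ofFn X) (pivotFirst LS LP i + r)

/-- The match of `P_i` that begins at the index `v` of `Y` is a correct one: either there is no
deletion within `P_i` and it is the image of `P_i` in `Y`, or there is exactly one deletion
within `P_i` and it begins at the image of the first index of `P_i` or ends at the image of the last
index of `P_i`. -/
def IsCorrectMatch (LS LP : ℕ) {n : ℕ} (X D : Fin n → Bool) (i v : ℕ) : Prop :=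
  IsMatch LS LP X D i v ∧
    ((pivotDeletions LS LP D i = 0 ∧ v = indexMap D (pivotFirst LS LP i)) ∨
     (pivotDeletions LS LP D i = 1 ∧
        (v = indexMap D (pivotFirst LS LP i) ∨
          v + LP = indexMap D (pivotLast LS LP i) + 1)))

/-! ### The matching graph -/

/-- The vertices of the matching graph: the two auxiliary vertices `s`, `t` and the matches of
the pivots `P_1, …, P_{k-1}` in `Y`. -/
inductive Vertex (LS LP k : ℕ) {n : ℕ} (X D : Fin n → Bool) : Type
  | s : Vertex LS LP k X D
  | t : Vertex LS LP k X D
  | pivot (i v : ℕ) (hi : 1 ≤ i ∧ i < k) (h : IsMatch LS LP X D i v) : Vertex LS LP k X D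

namespace Vertex

variable {LS LP k n : ℕ} {X D : Fin n → Bool}

/-- The layer, one of `0, …, k`. -/
def layer : Vertex LS LP k X D → ℕ
  | s => 0
  | t => k
  | pivot i _ _ _ => i

/-- The first index in `Y` (that of `s` plays no role: no edge ends in `s`). -/
def first : Vertex LS LP k X D → ℕ
  | s => 0
  | t => (output X D).length + 1
  | pivot _ v _ _ => v

/-- The last index in `Y` (that of `t` plays no role: no edge starts in `t`). -/
def last : Vertex LS LP k X D → ℕ
  | s => 0
  | t => (output X D).length + 1
  | pivot _ v _ _ => v + LP - 1

/-- The distance `Dis(u, v)`, an integer. -/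
def dis (u v : Vertex LS LP k X D) : ℤ := (v.first : ℤ) - u.last - 1

/-- The vertex is a correct match of a pivot. -/
def IsGood : Vertex LS LP k X D → Prop
  | s => False
  | t => False
  | pivot i v _ _ => IsCorrectMatch LS LP X D i v

end Vertex

/-- The matching graph, with its edges directed towards higher layers. -/
def matchingGraph (LS LP k : ℕ) {n : ℕ} (X D : Fin n → Bool) : Digraph (Vertex LS LP k X D) where
  Adj u v := u.layer < v.layer ∧ -1 ≤ u.dis v ∧
    u.dis v ≤ ((v.layer : ℤ) - u.layer - 1) * LP + ((v.layer : ℤ) - u.layer) * LS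

/-- `Q` is the list of the vertices of a path from `s` to `t` in the matching graph, in order.
(No vertex is repeated, since layers increase along edges.) -/
def IsSTPath {LS LP k n : ℕ} {X D : Fin n → Bool} (Q : List (Vertex LS LP k X D)) : Prop :=
  Q.head? = some Vertex.s ∧ Q.getLast? = some Vertex.t ∧
    Q.IsChain (matchingGraph LS LP k X D).Adj

open scoped Classical in
/-- The number of vertices on `Q` that are correct matches. -/
noncomputable def goodCount {LS LP k n : ℕ} {X D : Fin n → Bool}
    (Q : List (Vertex LS LP k X D)) : ℕ :=
  Q.countP fun u => decide u.IsGood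

/-- `R = 1 - L_P β + 2 β`. -/
noncomputable def rate (LP : ℕ) (β : ℝ) : ℝ := 1 - LP * β + 2 * β

/-! ### The random input and the random deletion pattern -/

/-- The point `1 / 2` of the unit interval. -/
noncomputable def oneHalf : unitInterval := ⟨1 / 2, by norm_num, by norm_num⟩

/-- The joint law of `(X, D)`: the bits of `X` are Bernoulli with parameter `1/2`, every bit is
deleted with probability `β`, and everything is independent. -/
noncomputable def channelLaw (n : ℕ) (β : unitInterval) :
    Measure ((Fin n → Bool) × (Fin n → Bool)) :=
  (Measure.pi fun _ : Fin n => bernoulliMeasure true false oneHalf).prod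
    (Measure.pi fun _ : Fin n => bernoulliMeasure true false β)

end PivotMatching

/-! Apart from `s` and `t`, a path consists of correct matches, of matches of pivots with at least
two deletions, and of "bad" vertices: incorrect matches of pivots with at most one deletion. Pivots
with two deletions number O((L_P β)² k) = o(βk), so it suffices to show that fewer than βk vertices
are bad.

Every vertex that is not bad lies in a usable layer: the pivot has no deletion, or at least two, or
it is `IsNear`. The last case has probability 2β + o(β), which explains the term 2β in R, and by a
Chernoff bound there are at most Rk + o(βk) usable layers (`bitLaw₂_isUsable_le`,
`bitLaw₂_count_le`). A path with about Rk vertices therefore has to make up by bad vertices for the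
deletion-free layers in which it has no correct match (`IsSTPath.exists_word`).

Bad vertices are expensive. For fixed `D`, a bad match has no bit in its right place, so it imposes
L_P equations between distinct bits of `X`, and all equations along a path are independent
(`bitLaw_equations_le`, `bitLaw_matches_le`): each bad match costs 2^(-L_P) ≤ β²/2048. For the union
bound, a run of bad matches is located relative to the correct match before it, which `D` determines
up to one bit; each bad match then has only L_S + L_P + 2 offsets, about 1/β. Layers skipped within
a run also carry one bit each; this is paid for because most of them are deletion-free, hence lost.
Weighting by 8^(2·bad − clean) makes both effects summable: the words have total weight at most 2(1
+ 3β/16)^k (`wordSum_wordWeight_le`), which is beaten by the Markov factor 8^(-t) with t ≥ βk/2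
(`bitLaw₂_exists_word_le`, `word_bound_le`). -/

namespace PivotMatching

/-! ### Products of Bernoulli measures -/

section Bernoulli

variable {κ : Type*} [Fintype κ]

/-- The law of independent bits, each of which is `true` with probability `p`. -/
noncomputable abbrev bitLaw (κ : Type*) [Fintype κ] (p : unitInterval) : Measure (κ → Bool) :=
  Measure.pi fun _ : κ => bernoulliMeasure true false p

lemma integrable_bits {Ω : Type*} [Finite Ω] [MeasurableSpace Ω] [MeasurableSingletonClass Ω]
    (μ : Measure Ω) [IsFiniteMeasure μ] (f : Ω → ℝ) : Integrable f μ :=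
  Integrable.of_finite

lemma integral_mul_of_dependsOn (p : unitInterval) {f g : (κ → Bool) → ℝ} {A B : Finset κ}
    (hAB : Disjoint A B) (hf : DependsOn f A) (hg : DependsOn g B) :
    ∫ ω, f ω * g ω ∂bitLaw κ p = (∫ ω, f ω ∂bitLaw κ p) * ∫ ω, g ω ∂bitLaw κ p := by
  classical
  have hind : iIndepFun (fun (i : κ) (ω : κ → Bool) => ω i) (bitLaw κ p) :=
    iIndepFun_pi (X := fun _ => id) fun _ => aemeasurable_id
  have h := hind.indepFun_finset A B hAB fun i => measurable_pi_apply i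
  have key : ∀ {f : (κ → Bool) → ℝ} {A : Finset κ}, DependsOn f A →
      ∃ F : (A → Bool) → ℝ, ∀ ω, f ω = F fun i => ω i := fun {f A} hf => by
    refine ⟨fun z => f fun i => if hi : i ∈ A then z ⟨i, hi⟩ else false, fun ω => hf fun i hi => ?_⟩
    simp [Finset.mem_coe.1 hi]
  obtain ⟨F, hF⟩ := key hf
  obtain ⟨G, hG⟩ := key hg
  have h2 := h.comp (φ := F) (ψ := G) (measurable_of_finite F) (measurable_of_finite G)
  simp only [hF, hG]
  exact h2.integral_mul_eq_mul_integral (measurable_of_finite _).aestronglyMeasurable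
    (measurable_of_finite _).aestronglyMeasurable

lemma integral_prod_of_dependsOn (p : unitInterval) {ι : Type*} (T : Finset ι)
    (f : ι → (κ → Bool) → ℝ) (A : ι → Finset κ)
    (hA : (T : Set ι).PairwiseDisjoint A) (hf : ∀ i ∈ T, DependsOn (f i) (A i)) :
    ∫ ω, ∏ i ∈ T, f i ω ∂bitLaw κ p = ∏ i ∈ T, ∫ ω, f i ω ∂bitLaw κ p := by
  classical
  induction T using Finset.induction_on with
  | empty => simp
  | insert a T ha ih =>
    simp only [Finset.prod_insert ha]
    rw [← ih (hA.subset (by simp)) fun i hi => hf i (Finset.mem_insert_of_mem hi)]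
    refine integral_mul_of_dependsOn p (A := A a) (B := T.biUnion A) ?_ (hf a (by simp)) ?_
    · rw [Finset.disjoint_biUnion_right]
      intro i hi
      exact hA (by simp) (by simp [hi]) fun h => ha (h ▸ hi)
    · intro ω ω' h
      refine Finset.prod_congr rfl fun i hi => hf i (Finset.mem_insert_of_mem hi) fun j hj => h j ?_
      simpa using ⟨i, hi, hj⟩

lemma bitLaw_real_forall_false (p : unitInterval) (s : Finset κ) :
    (bitLaw κ p).real {ω | ∀ i ∈ s, ω i = false} = (1 - (p : ℝ)) ^ s.card := by
  classical
  have : {ω : κ → Bool | ∀ i ∈ s, ω i = false}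
      = Set.pi Set.univ fun i => if i ∈ s then {false} else Set.univ := by
    ext ω
    simp only [Set.mem_ofPred_eq, Set.mem_pi, Set.mem_univ, true_imp_iff]
    refine forall_congr' fun i => ?_
    by_cases h : i ∈ s <;> simp [h]
  rw [this, Measure.real, Measure.pi_pi, ENNReal.toReal_prod]
  have h2 : ∀ i, ((bernoulliMeasure true false p) (if i ∈ s then ({false} : Set Bool) else Set.univ)).toReal
      = if i ∈ s then 1 - (p : ℝ) else 1 := fun i => by
    by_cases h : i ∈ s <;> simp [h]
  simp only [h2]
  simp

lemma bitLaw_real_forall_true (p : unitInterval) (s : Finset κ) :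
    (bitLaw κ p).real {ω | ∀ i ∈ s, ω i = true} = (p : ℝ) ^ s.card := by
  classical
  have : {ω : κ → Bool | ∀ i ∈ s, ω i = true}
      = Set.pi Set.univ fun i => if i ∈ s then {true} else Set.univ := by
    ext ω
    simp only [Set.mem_ofPred_eq, Set.mem_pi, Set.mem_univ, true_imp_iff]
    refine forall_congr' fun i => ?_
    by_cases h : i ∈ s <;> simp [h]
  rw [this, Measure.real, Measure.pi_pi, ENNReal.toReal_prod]
  have h2 : ∀ i, ((bernoulliMeasure true false p) (if i ∈ s then ({true} : Set Bool) else Set.univ)).toReal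
      = if i ∈ s then (p : ℝ) else 1 := fun i => by
    by_cases h : i ∈ s <;> simp [h]
  simp only [h2]
  simp

lemma bitLaw_oneHalf_real_singleton (ω : κ → Bool) :
    (bitLaw κ oneHalf).real {ω} = (1 / 2) ^ Fintype.card κ := by
  rw [Measure.real, Measure.pi_singleton, ENNReal.toReal_prod]
  have h2 : ∀ i, ((bernoulliMeasure true false oneHalf) {ω i}).toReal = 1 / 2 := fun i => by
    cases ω i <;> norm_num [oneHalf]
  simp [h2]

lemma bitLaw_oneHalf_real (S : Finset (κ → Bool)) :
    (bitLaw κ oneHalf).real S = S.card * (1 / 2) ^ Fintype.card κ := by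
  rw [← sum_measureReal_singleton S]
  simp only [bitLaw_oneHalf_real_singleton, Finset.sum_const, nsmul_eq_mul]

/-- Equations between bits along a monotone map without fixed points are independent. -/
lemma bitLaw_equations_le [LinearOrder κ] {ι : Type*} [Fintype ι] (x y : ι → κ)
    (hx : Function.Injective x) (hxy : ∀ e, y e ≠ x e)
    (hmono : ∀ e e', x e < x e' → y e ≤ y e') :
    (bitLaw κ oneHalf).real {X | ∀ e, X (x e) = X (y e)} ≤ (1 / 2) ^ Fintype.card ι := by
  classical
  set S : Finset (κ → Bool) := Finset.univ.filter fun X => ∀ e, X (x e) = X (y e)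
  have hS : {X : κ → Bool | ∀ e, X (x e) = X (y e)} = S := by simp [S]
  rw [hS, bitLaw_oneHalf_real]
  set dom : Finset κ := Finset.univ.image x
  have hdom : dom.card = Fintype.card ι := by
    simp [dom, Finset.card_image_of_injective _ hx]
  -- A solution is determined by its bits outside the image of `x`. Otherwise two solutions differ
  -- on a set of equations closed under passing from `x e` to `y e`.
  have hinj : Set.InjOn (fun (X : κ → Bool) (i : {i // i ∈ domᶜ}) => X i) S := by
    intro X hX X' hX' h
    simp only [S, Finset.coe_filter, Finset.mem_univ, true_and, Set.mem_ofPred_eq] at hX hX'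
    set E : Finset ι := Finset.univ.filter fun e => X (x e) ≠ X' (x e)
    have hout : ∀ i, X i ≠ X' i → ∃ e ∈ E, x e = i := by
      intro i hi
      by_cases hid : i ∈ dom
      · obtain ⟨e, -, rfl⟩ := Finset.mem_image.1 hid
        exact ⟨e, by simp [E, hi], rfl⟩
      · exact absurd (congrFun h ⟨i, by simpa using hid⟩) hi
    have hstep : ∀ e ∈ E, ∃ e' ∈ E, x e' = y e := by
      intro e he
      refine hout _ ?_
      rw [← hX, ← hX']
      simpa [E] using he
    by_contra hne
    obtain ⟨i, hi⟩ := Function.ne_iff.1 hne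
    obtain ⟨e, he, -⟩ := hout i hi
    obtain ⟨e₀, he₀, hmin⟩ := E.exists_min_image x ⟨e, he⟩
    -- At the lowest disagreement `y` must point upwards. At the highest disagreement where it does
    -- so, monotonicity forces `y` to point upwards once more at the target, a contradiction.
    have hup : (E.filter fun e => x e < y e).Nonempty := by
      obtain ⟨e', he', hee'⟩ := hstep e₀ he₀
      refine ⟨e₀, Finset.mem_filter.2 ⟨he₀, lt_of_le_of_ne ?_ (hxy e₀).symm⟩⟩
      rw [← hee']
      exact hmin e' he'
    obtain ⟨e₁, he₁, hmax⟩ := Finset.exists_max_image _ x hup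
    obtain ⟨he₁E, hlt⟩ := Finset.mem_filter.1 he₁
    obtain ⟨e₂, he₂, h12⟩ := hstep e₁ he₁E
    have h3 : y e₁ ≤ y e₂ := hmono _ _ (h12 ▸ hlt)
    have h4 : x e₂ < y e₂ := lt_of_le_of_ne (h12 ▸ h3) (hxy e₂).symm
    have h5 := hmax e₂ (Finset.mem_filter.2 ⟨he₂, h4⟩)
    rw [h12] at h5
    exact absurd hlt (not_lt.2 h5)
  have hcard : S.card ≤ 2 ^ (Fintype.card κ - Fintype.card ι) := by
    have := Finset.card_le_card_of_injOn (t := Finset.univ) _ (fun _ _ => Finset.mem_univ _) hinj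
    refine this.trans (le_of_eq ?_)
    rw [Finset.card_univ, Fintype.card_fun, Fintype.card_bool, Fintype.card_coe,
      Finset.card_compl, hdom]
  have hle : Fintype.card ι ≤ Fintype.card κ := Fintype.card_le_of_injective x hx
  calc (S.card : ℝ) * (1 / 2) ^ Fintype.card κ
      ≤ (2 : ℝ) ^ (Fintype.card κ - Fintype.card ι) * (1 / 2) ^ Fintype.card κ := by
        gcongr
        exact_mod_cast hcard
    _ = (1 / 2) ^ Fintype.card ι := by
        obtain ⟨d, hd⟩ := Nat.exists_eq_add_of_le hle
        rw [hd, Nat.add_sub_cancel_left, pow_add, mul_comm, mul_assoc, ← mul_pow]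
        norm_num

/-- The joint law of two families of independent bits. -/
noncomputable abbrev bitLaw₂ (κ : Type*) [Fintype κ] (p q : unitInterval) :
    Measure ((κ → Bool) × (κ → Bool)) :=
  (bitLaw κ p).prod (bitLaw κ q)

/-- Fubini: for fixed `D` the factors live on disjoint blocks of `X`, and their partial integrals
then live on disjoint blocks of `D`. -/
lemma integral_prod_of_dependsOn₂ (p q : unitInterval) {ι : Type*} (T : Finset ι)
    (f : ι → (κ → Bool) × (κ → Bool) → ℝ) (A : ι → Finset κ)
    (hA : (T : Set ι).PairwiseDisjoint A)
    (hf : ∀ i ∈ T, ∀ X X' D D' : κ → Bool, (∀ j ∈ A i, X j = X' j) → (∀ j ∈ A i, D j = D' j) →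
      f i (X, D) = f i (X', D')) :
    ∫ z, ∏ i ∈ T, f i z ∂bitLaw₂ κ p q = ∏ i ∈ T, ∫ z, f i z ∂bitLaw₂ κ p q := by
  rw [integral_prod_symm _ (integrable_bits _ _)]
  have h1 : ∀ D : κ → Bool, ∫ X, ∏ i ∈ T, f i (X, D) ∂bitLaw κ p
      = ∏ i ∈ T, ∫ X, f i (X, D) ∂bitLaw κ p := fun D =>
    integral_prod_of_dependsOn p T (fun i X => f i (X, D)) A hA
      fun i hi X X' h => hf i hi X X' D D (fun j hj => h j hj) fun _ _ => rfl
  simp only [h1]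
  rw [integral_prod_of_dependsOn q T (fun i D => ∫ X, f i (X, D) ∂bitLaw κ p) A hA]
  · exact Finset.prod_congr rfl fun i _ => (integral_prod_symm _ (integrable_bits _ _)).symm
  · intro i hi D D' h
    exact integral_congr_ae (ae_of_all _ fun X => hf i hi X X D D' (fun _ _ => rfl) fun j hj => h j hj)

lemma measurableSet_bits {Ω : Type*} [Finite Ω] [MeasurableSpace Ω] [MeasurableSingletonClass Ω]
    (s : Set Ω) : MeasurableSet s :=
  s.toFinite.measurableSet

/-- Markov's inequality in the form that serves both the Chernoff bound and the union bound over
words. -/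
lemma real_le_integral {Ω : Type*} [Finite Ω] [MeasurableSpace Ω] [MeasurableSingletonClass Ω]
    (μ : Measure Ω) [IsFiniteMeasure μ] (s : Set Ω) (f : Ω → ℝ) (hf : ∀ ω, 0 ≤ f ω)
    (h : ∀ ω ∈ s, 1 ≤ f ω) : μ.real s ≤ ∫ ω, f ω ∂μ := by
  rw [← integral_indicator_one (measurableSet_bits s)]
  refine integral_mono (integrable_bits _ _) (integrable_bits _ _) fun ω => ?_
  by_cases hω : ω ∈ s
  · simpa [hω] using h ω hω
  · simpa [hω] using hf ω

open scoped Classical in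
/-- A Chernoff bound for the number of events among a family of events that depend on disjoint
blocks of bits. -/
lemma bitLaw₂_count_le (p q : unitInterval) {ι : Type*} (T : Finset ι)
    (E : ι → Set ((κ → Bool) × (κ → Bool))) (A : ι → Finset κ)
    (hA : (T : Set ι).PairwiseDisjoint A)
    (hE : ∀ i ∈ T, ∀ X X' D D' : κ → Bool, (∀ j ∈ A i, X j = X' j) → (∀ j ∈ A i, D j = D' j) →
      (X, D) ∈ E i → (X', D') ∈ E i)
    {r δ K : ℝ} (hr0 : 0 ≤ r) (hr1 : r ≤ 1) (hδ0 : 0 ≤ δ) (hδ1 : δ ≤ 1) (hT : (T.card : ℝ) ≤ K)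
    (hP : ∀ i ∈ T, (bitLaw₂ κ p q).real (E i) ≤ r) :
    (bitLaw₂ κ p q).real {z | (r + δ) * K < ((T.filter fun i => z ∈ E i).card : ℝ)}
      ≤ Real.exp (-(δ ^ 2 / 4 * K)) := by
  -- With exp l − 1 ≤ l + l² and r ≤ 1 the exponent per trial is at most −lδ + l², which is minimal,
  -- namely −δ²/4, at this `l`.
  set l : ℝ := δ / 2
  have hK : 0 ≤ K := le_trans (Nat.cast_nonneg _) hT
  have hl0 : 0 ≤ l := by positivity
  set f : ι → (κ → Bool) × (κ → Bool) → ℝ := fun i z => if z ∈ E i then Real.exp l else 1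
  have hprod : ∀ z, ∏ i ∈ T, f i z = Real.exp (l * ((T.filter fun i => z ∈ E i).card : ℝ)) := by
    intro z
    simp only [f]
    rw [Finset.prod_ite]
    simp [← Real.exp_nat_mul, mul_comm]
  have hint : ∀ i ∈ T, ∫ z, f i z ∂bitLaw₂ κ p q ≤ Real.exp (r * (l + l ^ 2)) := by
    intro i hi
    have h1 : ∀ z, f i z = 1 + (E i).indicator 1 z * (Real.exp l - 1) := by
      intro z
      by_cases hz : z ∈ E i <;> simp [f, hz]
    simp only [h1]
    rw [integral_add (integrable_bits _ _) (integrable_bits _ _), integral_mul_const,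
      integral_indicator_one (measurableSet_bits _)]
    simp only [integral_const, probReal_univ, smul_eq_mul, mul_one]
    have h2 : Real.exp l - 1 ≤ l + l ^ 2 := by
      have := Real.abs_exp_sub_one_sub_id_le (x := l) (by rw [abs_of_nonneg hl0]; simp only [l]; linarith)
      have := le_abs_self (Real.exp l - 1 - l)
      linarith
    have h3 : 0 ≤ Real.exp l - 1 := by linarith [Real.add_one_le_exp l]
    calc 1 + (bitLaw₂ κ p q).real (E i) * (Real.exp l - 1)
        ≤ 1 + r * (l + l ^ 2) := by
          gcongr
          exact hP i hi
      _ ≤ _ := by linarith [Real.add_one_le_exp (r * (l + l ^ 2))]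
  have hf0 : ∀ i z, 0 ≤ f i z := fun i z => by
    by_cases hz : z ∈ E i <;> simp [f, hz, Real.exp_nonneg]
  calc (bitLaw₂ κ p q).real {z | (r + δ) * K < ((T.filter fun i => z ∈ E i).card : ℝ)}
      ≤ ∫ z, Real.exp (-(l * ((r + δ) * K))) * ∏ i ∈ T, f i z ∂bitLaw₂ κ p q := by
        refine real_le_integral _ _ _ (fun z => ?_) fun z hz => ?_
        · exact mul_nonneg (Real.exp_nonneg _) (Finset.prod_nonneg fun i _ => hf0 i z)
        · rw [hprod, ← Real.exp_add, Real.one_le_exp_iff]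
          have : l * ((r + δ) * K) ≤ l * ((T.filter fun i => z ∈ E i).card : ℝ) := by
            gcongr
            exact le_of_lt hz
          linarith
    _ = Real.exp (-(l * ((r + δ) * K))) * ∏ i ∈ T, ∫ z, f i z ∂bitLaw₂ κ p q := by
        rw [integral_const_mul, integral_prod_of_dependsOn₂ p q T f A hA]
        intro i hi X X' D D' hX hD
        have : (X, D) ∈ E i ↔ (X', D') ∈ E i :=
          ⟨hE i hi X X' D D' hX hD, hE i hi X' X D' D (fun j hj => (hX j hj).symm)
            fun j hj => (hD j hj).symm⟩
        simp only [f, this]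
    _ ≤ Real.exp (-(l * ((r + δ) * K))) * ∏ i ∈ T, Real.exp (r * (l + l ^ 2)) := by
        refine mul_le_mul_of_nonneg_left ?_ (Real.exp_nonneg _)
        exact Finset.prod_le_prod (fun i _ => integral_nonneg (hf0 i)) hint
    _ = Real.exp (-(l * ((r + δ) * K)) + T.card * (r * (l + l ^ 2))) := by
        rw [Finset.prod_const, ← Real.exp_nat_mul, Real.exp_add]
    _ ≤ Real.exp (-(δ ^ 2 / 4 * K)) := by
        rw [Real.exp_le_exp]
        have h4 : (T.card : ℝ) * (r * (l + l ^ 2)) ≤ K * (r * (l + l ^ 2)) := by gcongr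
        have h5 : K * (r * l ^ 2) ≤ K * (1 * l ^ 2) := by gcongr
        have h6 : δ = 2 * l := by simp only [l]; ring
        rw [h6]
        linarith

lemma bitLaw_real_apply_true (p : unitInterval) (i : κ) :
    (bitLaw κ p).real {ω | ω i = true} = p := by
  simpa using bitLaw_real_forall_true p {i}

end Bernoulli

/-! ### The index map -/

section IndexMap

variable {n : ℕ}

/-- A string, extended by `false` to all indices. Here indices start at `0`. -/
def extend (Z : Fin n → Bool) (q : ℕ) : Bool := if h : q < n then Z ⟨q, h⟩ else false

lemma extend_val (Z : Fin n → Bool) (j : Fin n) : extend Z j = Z j := by simp [extend]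

/-- The number of deletions in the window `[a, b)` (indices starting at `0`). -/
def windowDeletions (D : Fin n → Bool) (a b : ℕ) : ℕ :=
  ((Finset.Ico a b).filter fun q => extend D q = true).card

lemma windowDeletions_add (D : Fin n → Bool) {a b c : ℕ} (hab : a ≤ b) (hbc : b ≤ c) :
    windowDeletions D a b + windowDeletions D b c = windowDeletions D a c := by
  unfold windowDeletions
  rw [← Finset.card_union_of_disjoint, ← Finset.filter_union, Finset.Ico_union_Ico_eq_Ico hab hbc]
  exact Finset.disjoint_filter_filter (Finset.Ico_disjoint_Ico_consecutive a b c)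

lemma windowDeletions_eq_card (D : Fin n → Bool) (a b : ℕ) :
    windowDeletions D a b
      = (Finset.univ.filter fun j : Fin n => a ≤ j.val ∧ j.val < b ∧ D j = true).card := by
  symm
  refine Finset.card_nbij (fun j => j.val) ?_ ?_ ?_
  · intro j hj
    simp only [Finset.coe_filter, Finset.mem_univ, true_and, Set.mem_ofPred_eq] at hj
    simp [hj, extend]
  · exact fun _ _ _ _ h => Fin.ext h
  · intro q hq
    rw [Finset.mem_coe, Finset.mem_filter, Finset.mem_Ico] at hq
    obtain ⟨⟨h1, h2⟩, h3⟩ := hq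
    unfold extend at h3
    split_ifs at h3 with h
    exact ⟨⟨q, h⟩, by simp [h1, h2, h3], rfl⟩

lemma windowDeletions_succ (D : Fin n → Bool) (a : ℕ) :
    windowDeletions D a (a + 1) = if extend D a = true then 1 else 0 := by
  simp only [windowDeletions, Nat.Ico_succ_singleton, Finset.filter_singleton]
  split_ifs <;> simp

lemma indexMap_succ (D : Fin n → Bool) {q : ℕ} (hq : q < n) :
    indexMap D (q + 1) + windowDeletions D q (q + 1) = indexMap D q + 1 := by
  rw [windowDeletions_succ]
  unfold indexMap
  by_cases h : D ⟨q, hq⟩ = true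
  · have h2 : extend D q = true := by simpa [extend, hq] using h
    simp only [h2, if_true, add_left_inj]
    congr 1
    ext j
    simp only [Finset.mem_filter, Finset.mem_univ, true_and]
    refine ⟨fun ⟨h3, h4⟩ => ⟨?_, h4⟩, fun ⟨h3, h4⟩ => ⟨by omega, h4⟩⟩
    rcases Nat.lt_or_ge j.val q with h5 | h5
    · exact h5
    · have : j = ⟨q, hq⟩ := Fin.ext (show j.val = q by omega)
      simp [this, h] at h4
  · have h2 : ¬ extend D q = true := by simpa [extend, hq] using h
    rw [if_neg h2, add_zero, ← Finset.card_insert_of_notMem (a := (⟨q, hq⟩ : Fin n)) (by simp)]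
    congr 1
    ext j
    simp only [Finset.mem_filter, Finset.mem_univ, true_and, Finset.mem_insert, Fin.ext_iff]
    refine ⟨fun ⟨h3, h4⟩ => ?_, ?_⟩
    · rcases Nat.lt_or_ge j.val q with h5 | h5
      · exact Or.inr ⟨h5, h4⟩
      · exact Or.inl (by omega)
    · rintro (h3 | ⟨h3, h4⟩)
      · refine ⟨by omega, ?_⟩
        have : j = ⟨q, hq⟩ := Fin.ext h3
        simpa [this] using h
      · exact ⟨by omega, h4⟩

/-- The additive form avoids truncated subtraction; all comparisons of positions in `X` and `Y`
reduce to it. -/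
lemma indexMap_add_windowDeletions (D : Fin n → Bool) {a b : ℕ} (hab : a ≤ b) (hb : b ≤ n) :
    indexMap D b + windowDeletions D a b = indexMap D a + (b - a) := by
  induction b, hab using Nat.le_induction with
  | base => simp [windowDeletions]
  | succ b hab ih =>
    have h1 := ih (by omega)
    have h2 := indexMap_succ D (q := b) (by omega)
    have h3 := windowDeletions_add D hab (Nat.le_succ b)
    simp only [Nat.succ_eq_add_one] at h3
    omega

/-- The undeleted positions, in order. -/
def undeleted (D : Fin n → Bool) : List (Fin n) := (List.finRange n).filter fun i => !(D i)

lemma undeleted_sorted (D : Fin n → Bool) : (undeleted D).SortedLT :=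
  (List.Pairwise.filter _ (List.pairwise_lt_finRange n)).sortedLT

lemma mem_undeleted (D : Fin n → Bool) (j : Fin n) : j ∈ undeleted D ↔ D j = false := by
  simp [undeleted]

lemma output_eq (X D : Fin n → Bool) : output X D = (undeleted D).map X := rfl

/-- The list is increasing, so the undeleted positions up to its entry at `a` are exactly its first
`a + 1` entries. -/
lemma indexMap_undeleted (D : Fin n → Bool) (a : ℕ) (ha : a < (undeleted D).length) :
    indexMap D ((undeleted D)[a].val + 1) = a + 1 := by
  have hmono := (undeleted_sorted D).strictMono_get
  rw [← Finset.card_range (a + 1)]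
  symm
  refine Finset.card_bij (fun b hb => (undeleted D)[b]'(by
    have := Finset.mem_range.1 hb; omega)) ?_ ?_ ?_
  · intro b hb
    have hb' := Finset.mem_range.1 hb
    have h1 := hmono.monotone (show (⟨b, by omega⟩ : Fin _) ≤ ⟨a, ha⟩ from
      Nat.lt_succ_iff.1 hb')
    simp only [Finset.mem_filter, Finset.mem_univ, true_and]
    exact ⟨Nat.succ_le_succ h1, (mem_undeleted D _).1 (List.getElem_mem _)⟩
  · intro b hb c hc h
    have := hmono.injective (a₁ := ⟨b, by have := Finset.mem_range.1 hb; omega⟩)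
      (a₂ := ⟨c, by have := Finset.mem_range.1 hc; omega⟩) h
    simpa using this
  · intro j hj
    simp only [Finset.mem_filter, Finset.mem_univ, true_and] at hj
    obtain ⟨b, hb, rfl⟩ := List.getElem_of_mem ((mem_undeleted D j).2 hj.2)
    have h1 : (undeleted D).get ⟨b, hb⟩ ≤ (undeleted D).get ⟨a, ha⟩ := Nat.le_of_succ_le_succ hj.1
    have h2 := hmono.le_iff_le.1 h1
    exact ⟨b, Finset.mem_range.2 (Nat.lt_succ_of_le h2), rfl⟩

lemma bit_output (X D : Fin n → Bool) (a : ℕ) (ha : a < (undeleted D).length) :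
    bit (output X D) (a + 1) = some (X ((undeleted D)[a])) := by
  simp [bit, output_eq, ha]

lemma bit_ofFn (X : Fin n → Bool) (j : Fin n) : bit (List.ofFn X) (j.val + 1) = some (X j) := by
  simp [bit]

lemma bit_ofFn' (X : Fin n → Bool) {q : ℕ} (hq : q < n) :
    bit (List.ofFn X) (q + 1) = some (extend X q) := by
  simp [bit, extend, hq]

/-- The image in the output of an undeleted position. -/
lemma bit_output_indexMap (X D : Fin n → Bool) {q : ℕ} (hq : q < n) (hD : extend D q = false) :
    bit (output X D) (indexMap D (q + 1)) = some (extend X q) := by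
  have hD' : D ⟨q, hq⟩ = false := by simpa [extend, hq] using hD
  obtain ⟨a, ha, h⟩ := List.getElem_of_mem ((mem_undeleted D _).2 hD')
  have h1 := indexMap_undeleted D a ha
  rw [h] at h1
  simp only at h1
  rw [h1, bit_output X D a ha, h]
  simp [extend, hq]

end IndexMap

/-! ### Correct and incorrect matches -/

section Layers

variable {n : ℕ}

/-- The number of bits of the input before the pivot `P_i`. -/
def pivotStart (LS LP i : ℕ) : ℕ := i * LS + (i - 1) * LP

lemma pivotFirst_eq (LS LP i : ℕ) : pivotFirst LS LP i = pivotStart LS LP i + 1 := rfl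

lemma pivotLast_eq {LS LP i : ℕ} (hi : 1 ≤ i) : pivotLast LS LP i = pivotStart LS LP i + LP := by
  obtain ⟨i, rfl⟩ := Nat.exists_eq_add_of_le' hi
  simp [pivotLast, pivotStart]
  ring

lemma pivotDeletions_eq {LS LP i : ℕ} (hi : 1 ≤ i) (D : Fin n → Bool) :
    pivotDeletions LS LP D i
      = windowDeletions D (pivotStart LS LP i) (pivotStart LS LP i + LP) := by
  rw [windowDeletions_eq_card, pivotDeletions, pivotFirst_eq, pivotLast_eq hi]
  congr 1
  ext j
  simp only [Finset.mem_filter, Finset.mem_univ, true_and]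
  constructor <;> rintro ⟨h1, h2, h3⟩ <;> exact ⟨by omega, by omega, h3⟩

/-- There is a whole segment on either side of a pivot, so its two neighbouring bits exist. -/
lemma pivotStart_bounds {LS LP i k : ℕ} (hi : 1 ≤ i) (hik : i < k)
    (hn : n = k * LS + (k - 1) * LP) :
    LS ≤ pivotStart LS LP i ∧ pivotStart LS LP i + LP + LS ≤ n := by
  obtain ⟨i, rfl⟩ := Nat.exists_eq_add_of_le' hi
  obtain ⟨k, rfl⟩ := Nat.exists_eq_add_of_lt hik
  subst hn
  simp only [pivotStart, Nat.add_sub_cancel]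
  constructor
  · nlinarith
  · nlinarith [Nat.zero_le (k * LS), Nat.zero_le (k * LP)]

/-- An incorrect match of a pivot with at most one deletion has no bit in its right place. -/
lemma isCorrectMatch_of_indexMap_eq {LS LP i v r : ℕ} (hi : 1 ≤ i) {X D : Fin n → Bool}
    (hn : pivotStart LS LP i + LP ≤ n) (hr : r < LP) (hm : IsMatch LS LP X D i v)
    (hD : pivotDeletions LS LP D i ≤ 1)
    (h : indexMap D (pivotStart LS LP i + r + 1) = v + r) : IsCorrectMatch LS LP X D i v := by
  refine ⟨hm, ?_⟩
  rw [pivotDeletions_eq hi] at *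
  rw [pivotFirst_eq, pivotLast_eq hi]
  set a := pivotStart LS LP i
  -- With at most one deletion, one of the two sides of offset `r` has none, and on that side the
  -- match is aligned up to the end of the pivot.
  have h1 := windowDeletions_add D (show a ≤ a + r + 1 by omega) (show a + r + 1 ≤ a + LP by omega)
  have h2 := windowDeletions_add D (show a ≤ a + 1 by omega) (show a + 1 ≤ a + r + 1 by omega)
  have h3 := indexMap_add_windowDeletions D (show a + 1 ≤ a + r + 1 by omega) (by omega)
  have h4 := indexMap_add_windowDeletions D (show a + r + 1 ≤ a + LP by omega) hn
  omega

/-- The pivot `P_i` has a deletion next to which it may be repeated: there is a deletion in `P_i`,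
and a neighbour of `P_i` is deleted or all bits of `P_i` on one side of the deletion are equal
to the neighbour on this side. -/
def IsNear (LS LP : ℕ) (X D : Fin n → Bool) (i : ℕ) : Prop :=
  ∃ j < LP, extend D (pivotStart LS LP i + j) = true ∧
    (extend D (pivotStart LS LP i - 1) = true ∨ extend D (pivotStart LS LP i + LP) = true ∨
      (∀ r, j ≤ r → r < LP →
        extend X (pivotStart LS LP i + r) = extend X (pivotStart LS LP i + r + 1)) ∨
      ∀ r ≤ j, extend X (pivotStart LS LP i + r) = extend X (pivotStart LS LP i + r - 1))

lemma IsMatch.extend_eq {LS LP i v r q : ℕ} {X D : Fin n → Bool} (hm : IsMatch LS LP X D i v)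
    (hn : pivotStart LS LP i + LP ≤ n) (hr : r < LP) (hq : q < n) (hD : extend D q = false)
    (h : indexMap D (q + 1) = v + r) : extend X (pivotStart LS LP i + r) = extend X q := by
  have h1 := hm.2.2 r hr
  rw [← h, bit_output_indexMap X D hq hD, pivotFirst_eq,
    show pivotStart LS LP i + 1 + r = pivotStart LS LP i + r + 1 by omega,
    bit_ofFn' X (by omega)] at h1
  simpa using h1.symm

/-- Let offset `j` be the only deletion, with both neighbours of the pivot kept. If the match is
aligned at its first bit, the bits from `j` on are compared with their right neighbours; if it is
aligned at its last bit, those up to `j` are compared with their left neighbours. Either way they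
form a run. -/
lemma IsCorrectMatch.isNear {LS LP i v : ℕ} (hi : 1 ≤ i) {X D : Fin n → Bool}
    (ha0 : 1 ≤ pivotStart LS LP i) (hn : pivotStart LS LP i + LP < n)
    (h : IsCorrectMatch LS LP X D i v) (hD : pivotDeletions LS LP D i ≠ 0) :
    IsNear LS LP X D i := by
  obtain ⟨hm, h⟩ := h
  rcases h with ⟨h, -⟩ | ⟨h1, h⟩
  · exact absurd h hD
  rw [pivotDeletions_eq hi] at h1
  rw [pivotFirst_eq, pivotLast_eq hi] at h
  have hex := fun {r q} => hm.extend_eq (r := r) (q := q) hn.le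
  unfold IsNear
  set a := pivotStart LS LP i
  obtain ⟨q, hq⟩ := Finset.card_eq_one.1 h1
  have hq1 : ∀ p, a ≤ p → p < a + LP → (extend D p = true ↔ p = q) := fun p hp1 hp2 => by
    have := Finset.ext_iff.1 hq p
    simpa [hp1, hp2] using this
  have hq2 : (a ≤ q ∧ q < a + LP) ∧ extend D q = true := by
    have : q ∈ ({q} : Finset ℕ) := by simp
    rw [← hq] at this
    simpa using this
  obtain ⟨j, rfl⟩ := Nat.exists_eq_add_of_le hq2.1.1
  refine ⟨j, by omega, hq2.2, ?_⟩
  by_cases hprev : extend D (a - 1) = true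
  · exact Or.inl hprev
  by_cases hnext : extend D (a + LP) = true
  · exact Or.inr (Or.inl hnext)
  right; right
  have hfalse : ∀ p, a - 1 ≤ p → p ≤ a + LP → p ≠ a + j → extend D p = false := by
    intro p hp1 hp2 hp3
    rcases Nat.lt_or_ge p a with h | h
    · obtain rfl : p = a - 1 := by omega
      simpa using hprev
    · rcases Nat.lt_or_ge p (a + LP) with h4 | h4
      · have := (hq1 p h h4).not.2 hp3
        simpa using this
      · obtain rfl : p = a + LP := by omega
        simpa using hnext
  have hzero : ∀ b c, a - 1 ≤ b → c ≤ a + LP + 1 → (a + j < b ∨ c ≤ a + j) →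
      windowDeletions D b c = 0 := by
    intro b c hb hc hbc
    unfold windowDeletions
    rw [Finset.card_eq_zero, Finset.filter_eq_empty_iff]
    intro p hp
    rw [Finset.mem_Ico] at hp
    simp [hfalse p (by omega) (by omega) (by omega)]
  have hone : windowDeletions D (a + j) (a + j + 1) = 1 := by
    rw [windowDeletions_succ, if_pos hq2.2]
  have hj : j < LP := by omega
  rcases h with h | h
  -- If the first bit itself is deleted, `indexMap` takes the value of the bit before the pivot, so
  -- the match begins one place early and it is the run to the left that occurs.
  · rcases Nat.eq_zero_or_pos j with rfl | hj0
    · right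
      intro r hr
      obtain rfl : r = 0 := by omega
      refine hex (by omega) (by omega) (hfalse _ (by omega) (by omega) (by omega)) ?_
      have h5 := indexMap_succ D (q := a) (by omega)
      simp only [add_zero] at hone ⊢
      rw [hone] at h5
      rw [show a - 1 + 1 = a by omega]
      omega
    · left
      intro r hr hrL
      refine hex hrL (by omega) (hfalse _ (by omega) (by omega) (by omega)) ?_
      have h5 := indexMap_add_windowDeletions D (a := a + 1) (b := a + r + 1 + 1) (by omega) (by omega)
      have h6 := windowDeletions_add D (a := a + 1) (b := a + j) (c := a + r + 1 + 1)
        (by omega) (by omega)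
      have h7 := windowDeletions_add D (a := a + j) (b := a + j + 1) (c := a + r + 1 + 1)
        (by omega) (by omega)
      have h8 := hzero (a + 1) (a + j) (by omega) (by omega) (by omega)
      have h9 := hzero (a + j + 1) (a + r + 1 + 1) (by omega) (by omega) (by omega)
      omega
  · right
    intro r hr
    refine hex (by omega) (by omega) (hfalse _ (by omega) (by omega) (by omega)) ?_
    have h5 := indexMap_add_windowDeletions D (a := a + r) (b := a + LP) (by omega) (by omega)
    have h6 := windowDeletions_add D (a := a + r) (b := a + j) (c := a + LP) (by omega) (by omega)
    have h7 := windowDeletions_add D (a := a + j) (b := a + j + 1) (c := a + LP)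
      (by omega) (by omega)
    have h8 := hzero (a + r) (a + j) (by omega) (by omega) (by omega)
    have h9 := hzero (a + j + 1) (a + LP) (by omega) (by omega) (by omega)
    rw [show a + r - 1 + 1 = a + r by omega]
    omega

end Layers

/-! ### Probabilities of matches and of deletions in pivots -/

section Probabilities

variable {n : ℕ}

lemma pivotStart_add_le {LS LP i j : ℕ} (hi : 1 ≤ i) (hij : i < j) :
    pivotStart LS LP i + LP + LS ≤ pivotStart LS LP j := by
  obtain ⟨i, rfl⟩ := Nat.exists_eq_add_of_le' hi
  obtain ⟨j, rfl⟩ := Nat.exists_eq_add_of_lt hij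
  simp only [pivotStart, Nat.add_sub_cancel]
  nlinarith [Nat.zero_le (j * LS), Nat.zero_le (j * LP)]

/-- A list of pairs (layer, first index) in which layers and indices increase and no bit is
in its right place. -/
def IsDisplaced (LS LP k : ℕ) (D : Fin n → Bool) (L : List (ℕ × ℕ)) : Prop :=
  L.Pairwise (fun p q => p.1 < q.1 ∧ p.2 + LP ≤ q.2 + 1) ∧
    ∀ p ∈ L, (1 ≤ p.1 ∧ p.1 < k) ∧ ∀ r < LP, extend D (pivotStart LS LP p.1 + r) = false →
      indexMap D (pivotStart LS LP p.1 + r + 1) ≠ p.2 + r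

lemma bitLaw_matches_le {LS LP k : ℕ} (hn : n = k * LS + (k - 1) * LP) (D : Fin n → Bool)
    (L : List (ℕ × ℕ)) :
    (bitLaw (Fin n) oneHalf).real
      {X | IsDisplaced LS LP k D L ∧ ∀ p ∈ L, IsMatch LS LP X D p.1 p.2}
      ≤ (1 / 2) ^ (L.length * LP) := by
  set S : Set (Fin n → Bool) := {X | IsDisplaced LS LP k D L ∧ ∀ p ∈ L, IsMatch LS LP X D p.1 p.2}
    with hS
  -- `D` is fixed, so neither the displacement nor the length of the output depends on `X`; a single
  -- element of `S` certifies that all indices are in range.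
  rcases S.eq_empty_or_nonempty with h0 | ⟨X₀, hL, hX₀⟩
  · rw [h0]
    simp
  have hlen : ∀ X : Fin n → Bool, (output X D).length = (undeleted D).length := fun X => by
    simp [output_eq]
  have hmem : ∀ a : Fin L.length, L[a] ∈ L := fun a => List.getElem_mem _
  have hb : ∀ (a : Fin L.length) (r : Fin LP), pivotStart LS LP (L[a]).1 + r.val < n := fun a r => by
    have h1 := (hL.2 _ (hmem a)).1
    have h2 := pivotStart_bounds h1.1 h1.2 hn
    omega
  have hv : ∀ (a : Fin L.length) (r : Fin LP),
      1 ≤ (L[a]).2 ∧ (L[a]).2 + r.val - 1 < (undeleted D).length := fun a r => by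
    have h1 := hX₀ _ (hmem a)
    have h2 := h1.2.1
    rw [hlen] at h2
    have h3 := h1.1
    omega
  -- For offset `e.2` of match `e.1`, `x e` is the position within the pivot and `y e` the undeleted
  -- position whose image is read there. Output indices start at 1 and list indices at 0.
  set x : Fin L.length × Fin LP → Fin n := fun e => ⟨_, hb e.1 e.2⟩
  set y : Fin L.length × Fin LP → Fin n := fun e => (undeleted D).get ⟨_, (hv e.1 e.2).2⟩
  have hord : ∀ a b : Fin L.length, a < b → (L[a]).1 < (L[b]).1 ∧ (L[a]).2 + LP ≤ (L[b]).2 + 1 :=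
    fun a b hab => List.pairwise_iff_getElem.1 hL.1 a b a.2 b.2 hab
  have hsep : ∀ a b : Fin L.length, a < b →
      pivotStart LS LP (L[a]).1 + LP ≤ pivotStart LS LP (L[b]).1 := fun a b hab => by
    have := pivotStart_add_le (LS := LS) (LP := LP) (hL.2 _ (hmem a)).1.1 (hord a b hab).1
    omega
  have hlt : ∀ e e', x e < x e' → e.1 < e'.1 ∨ e.1 = e'.1 ∧ e.2 < e'.2 := by
    rintro ⟨a, r⟩ ⟨b, s⟩ h
    have h' : pivotStart LS LP (L[a]).1 + r.val < pivotStart LS LP (L[b]).1 + s.val := h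
    rcases lt_trichotomy a b with hab | rfl | hab
    · exact Or.inl hab
    · exact Or.inr ⟨rfl, by simpa using h'⟩
    · have := hsep b a hab
      omega
  have hx : Function.Injective x := by
    rintro ⟨a, r⟩ ⟨b, s⟩ h
    have h' : pivotStart LS LP (L[a]).1 + r.val = pivotStart LS LP (L[b]).1 + s.val :=
      congrArg Fin.val h
    rcases lt_trichotomy a b with hab | rfl | hab
    · have := hsep a b hab
      omega
    · exact Prod.ext rfl (Fin.ext (by simpa using h'))
    · have := hsep b a hab
      omega
  have hsub : S ⊆ {X | ∀ e, X (x e) = X (y e)} := by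
    rintro X ⟨-, hX⟩ ⟨a, r⟩
    have h1 := (hX _ (hmem a)).2.2 r.val r.2
    obtain ⟨h2, h3⟩ := hv a r
    rw [show (L[a]).2 + r.val = (L[a]).2 + r.val - 1 + 1 by omega, bit_output X D _ h3, pivotFirst_eq,
      show pivotStart LS LP (L[a]).1 + 1 + r.val = pivotStart LS LP (L[a]).1 + r.val + 1 by omega] at h1
    have h4 := bit_ofFn X ⟨_, hb a r⟩
    rw [h4] at h1
    exact (Option.some.inj h1).symm
  refine (measureReal_mono hsub).trans ?_
  refine (bitLaw_equations_le x y hx ?_ ?_).trans (le_of_eq (by simp))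
  -- An equation of a bit with itself would put an undeleted bit of the pivot in its right place.
  · rintro ⟨a, r⟩ h
    obtain ⟨h2, h3⟩ := hv a r
    have h4 := indexMap_undeleted D _ h3
    have h5 := (mem_undeleted D _).1 (List.getElem_mem h3)
    rw [show (undeleted D)[_]'h3 = (⟨_, hb a r⟩ : Fin n) from h] at h4 h5
    refine (hL.2 _ (hmem a)).2 r.val r.2 ?_ ?_
    · exact (extend_val D ⟨_, hb a r⟩).trans h5
    · simp only at h4
      rw [h4]
      simp only [Fin.getElem_fin] at *
      omega
  -- Consecutive matches may share one bit of `Y`, so `y` is only weakly increasing.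
  · rintro ⟨a, r⟩ ⟨b, s⟩ h
    refine (undeleted_sorted D).strictMono_get.monotone
      (show (⟨_, (hv a r).2⟩ : Fin _) ≤ ⟨_, (hv b s).2⟩ from ?_)
    simp only [Fin.mk_le_mk]
    rcases hlt _ _ h with h | ⟨h, h'⟩
    · have := (hord a b h).2
      simp only [Fin.getElem_fin] at *
      omega
    · simp only at h h'
      subst h
      omega

/-! ### Deletions and runs in a single pivot -/

lemma card_window {a LP : ℕ} (h : a + LP ≤ n) :
    (Finset.univ.filter fun j : Fin n => a ≤ j.val ∧ j.val < a + LP).card = LP := by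
  conv_rhs => rw [← Nat.add_sub_cancel_left (n := a) (m := LP), ← Nat.card_Ico]
  refine Finset.card_nbij (fun j => j.val) (fun j hj => ?_) (fun _ _ _ _ h => Fin.ext h) fun q hq => ?_
  · simpa using hj
  · have := Finset.mem_Ico.1 (Finset.mem_coe.1 hq)
    exact ⟨⟨q, by omega⟩, by simpa using this, rfl⟩

lemma windowDeletions_eq_zero_iff (D : Fin n → Bool) (a b : ℕ) :
    windowDeletions D a b = 0
      ↔ ∀ j ∈ Finset.univ.filter fun j : Fin n => a ≤ j.val ∧ j.val < b, D j = false := by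
  rw [windowDeletions_eq_card, Finset.card_eq_zero, Finset.filter_eq_empty_iff]
  simp

lemma bitLaw_window_zero (p : unitInterval) {a LP : ℕ} (h : a + LP ≤ n) :
    (bitLaw (Fin n) p).real {D | windowDeletions D a (a + LP) = 0} = (1 - (p : ℝ)) ^ LP := by
  simp only [windowDeletions_eq_zero_iff]
  rw [bitLaw_real_forall_false, card_window h]

lemma bitLaw_extend_pair_le (p : unitInterval) {a b : ℕ} (ha : a < n) (hb : b < n) (hab : a ≠ b) :
    (bitLaw (Fin n) p).real {D | extend D a = true ∧ extend D b = true} = (p : ℝ) ^ 2 := by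
  have h := bitLaw_real_forall_true p ({⟨a, ha⟩, ⟨b, hb⟩} : Finset (Fin n))
  rw [Finset.card_pair (by simpa using hab)] at h
  rw [← h]
  congr 1
  ext D
  simp [extend, ha, hb]

lemma bitLaw_extend (p : unitInterval) {a : ℕ} (ha : a < n) :
    (bitLaw (Fin n) p).real {D | extend D a = true} = (p : ℝ) := by
  rw [← bitLaw_real_apply_true p (⟨a, ha⟩ : Fin n)]
  simp [extend, ha]

lemma bitLaw_two_le_window (p : unitInterval) {a LP : ℕ} (h : a + LP ≤ n) :
    (bitLaw (Fin n) p).real {D | 2 ≤ windowDeletions D a (a + LP)} ≤ LP ^ 2 * (p : ℝ) ^ 2 := by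
  have hsub : {D : Fin n → Bool | 2 ≤ windowDeletions D a (a + LP)}
      ⊆ ⋃ e ∈ (Finset.Ico a (a + LP)).offDiag, {D | extend D e.1 = true ∧ extend D e.2 = true} := by
    intro D hD
    obtain ⟨b, hb, c, hc, hbc⟩ := Finset.one_lt_card.1 (show 1 < _ from hD)
    simp only [Finset.mem_filter] at hb hc
    simp only [Set.mem_iUnion]
    exact ⟨(b, c), Finset.mem_offDiag.2 ⟨hb.1, hc.1, hbc⟩, hb.2, hc.2⟩
  refine (measureReal_mono hsub (measure_ne_top _ _)).trans
    ((measureReal_biUnion_finset_le _ _).trans ?_)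
  have hle : ∀ e ∈ (Finset.Ico a (a + LP)).offDiag, (bitLaw (Fin n) p).real
      {D | extend D e.1 = true ∧ extend D e.2 = true} ≤ (p : ℝ) ^ 2 := by
    intro e he
    rw [Finset.mem_offDiag, Finset.mem_Ico, Finset.mem_Ico] at he
    exact (bitLaw_extend_pair_le p (by omega) (by omega) he.2.2).le
  refine (Finset.sum_le_card_nsmul _ _ _ hle).trans ?_
  rw [nsmul_eq_mul]
  gcongr
  rw [Finset.offDiag_card, Nat.card_Ico, Nat.add_sub_cancel_left]
  calc ((LP * LP - LP : ℕ) : ℝ) ≤ ((LP * LP : ℕ) : ℝ) := by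
        exact_mod_cast Nat.sub_le _ _
    _ = (LP : ℝ) ^ 2 := by push_cast; ring

lemma bitLaw_run_right_le {a m : ℕ} (h : a + m < n) :
    (bitLaw (Fin n) oneHalf).real {X | ∀ r < m, extend X (a + r) = extend X (a + r + 1)}
      ≤ (1 / 2) ^ m := by
  have := bitLaw_equations_le (fun e : Fin m => (⟨a + e.val, by omega⟩ : Fin n))
    (fun e : Fin m => (⟨a + e.val + 1, by omega⟩ : Fin n)) (fun e e' h => by simpa [Fin.ext_iff] using h)
    (fun e => by simp) (fun e e' h => by simpa using h.le)
  rw [Fintype.card_fin] at this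
  refine le_trans (measureReal_mono ?_) this
  intro X hX e
  have h1 := hX e.val e.2
  have h2 : a + e.val < n := by omega
  have h3 : a + e.val + 1 < n := by omega
  simpa [extend, h2, h3] using h1

lemma bitLaw_run_left_le {a m : ℕ} (ha : 1 ≤ a) (h : a + m ≤ n) :
    (bitLaw (Fin n) oneHalf).real {X | ∀ r < m, extend X (a + r) = extend X (a + r - 1)}
      ≤ (1 / 2) ^ m := by
  have := bitLaw_equations_le (fun e : Fin m => (⟨a + e.val, by omega⟩ : Fin n))
    (fun e : Fin m => (⟨a + e.val - 1, by omega⟩ : Fin n)) (fun e e' h => by simpa [Fin.ext_iff] using h)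
    (fun e => by simp only [ne_eq, Fin.mk.injEq]; omega)
    (fun e e' h => by simp only [Fin.mk_lt_mk, Fin.mk_le_mk] at *; omega)
  rw [Fintype.card_fin] at this
  refine le_trans (measureReal_mono ?_) this
  intro X hX e
  have h1 := hX e.val e.2
  have h2 : a + e.val < n := by omega
  have h3 : a + e.val - 1 < n := by omega
  simpa [extend, h2, h3] using h1

lemma sum_half_pow_le (m : ℕ) : ∑ j ∈ Finset.range m, (1 / 2 : ℝ) ^ (j + 1) ≤ 1 := by
  have h : ∀ m : ℕ, ∑ j ∈ Finset.range m, (1 / 2 : ℝ) ^ (j + 1) = 1 - (1 / 2) ^ m := by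
    intro m
    induction m with
    | zero => simp
    | succ m ih =>
      rw [Finset.sum_range_succ, ih]
      ring
  rw [h]
  have : (0 : ℝ) < (1 / 2) ^ m := by positivity
  linarith

/-- A deletion at offset `j` needs a run costing 2^(-(L_P − j)) on its right or 2^(-(j+1)) on its
left. Summed over `j`, each geometric series is at most 1, so runs contribute 2β whatever L_P is; a
deleted neighbour costs a second factor β. -/
lemma bitLaw₂_isNear_le (p : unitInterval) {LS LP i : ℕ} (ha : 1 ≤ pivotStart LS LP i)
    (hn : pivotStart LS LP i + LP < n) :
    (bitLaw₂ (Fin n) oneHalf p).real {z | IsNear LS LP z.1 z.2 i}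
      ≤ 2 * LP * (p : ℝ) ^ 2 + 2 * p := by
  unfold IsNear
  set a := pivotStart LS LP i
  have hp0 : (0 : ℝ) ≤ p := p.2.1
  set E₁ : ℕ → Set ((Fin n → Bool) × (Fin n → Bool)) := fun j =>
    Set.univ ×ˢ {D | extend D (a - 1) = true ∧ extend D (a + j) = true}
  set E₂ : ℕ → Set ((Fin n → Bool) × (Fin n → Bool)) := fun j =>
    Set.univ ×ˢ {D | extend D (a + LP) = true ∧ extend D (a + j) = true}
  set E₃ : ℕ → Set ((Fin n → Bool) × (Fin n → Bool)) := fun j =>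
    {X | ∀ r < LP - j, extend X (a + j + r) = extend X (a + j + r + 1)} ×ˢ
      {D | extend D (a + j) = true}
  set E₄ : ℕ → Set ((Fin n → Bool) × (Fin n → Bool)) := fun j =>
    {X | ∀ r < j + 1, extend X (a + r) = extend X (a + r - 1)} ×ˢ {D | extend D (a + j) = true}
  have hsub : {z : (Fin n → Bool) × (Fin n → Bool) | ∃ j < LP, extend z.2 (a + j) = true ∧
      (extend z.2 (a - 1) = true ∨ extend z.2 (a + LP) = true ∨
        (∀ r, j ≤ r → r < LP → extend z.1 (a + r) = extend z.1 (a + r + 1)) ∨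
        ∀ r ≤ j, extend z.1 (a + r) = extend z.1 (a + r - 1))}
      ⊆ ⋃ j ∈ Finset.range LP, (E₁ j ∪ E₂ j) ∪ (E₃ j ∪ E₄ j) := by
    rintro z ⟨j, hj, hD, h⟩
    simp only [Set.mem_iUnion, Finset.mem_range]
    refine ⟨j, hj, ?_⟩
    rcases h with h | h | h | h
    · exact Or.inl (Or.inl ⟨trivial, h, hD⟩)
    · exact Or.inl (Or.inr ⟨trivial, h, hD⟩)
    · refine Or.inr (Or.inl ⟨fun r hr => ?_, hD⟩)
      have := h (j + r) (by omega) (by omega)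
      rwa [← Nat.add_assoc] at this
    · exact Or.inr (Or.inr ⟨fun r hr => h r (by omega), hD⟩)
  refine (measureReal_mono hsub (measure_ne_top _ _)).trans
    ((measureReal_biUnion_finset_le _ _).trans ?_)
  have hle : ∀ j ∈ Finset.range LP, (bitLaw₂ (Fin n) oneHalf p).real ((E₁ j ∪ E₂ j) ∪ (E₃ j ∪ E₄ j))
      ≤ ((p : ℝ) ^ 2 + (p : ℝ) ^ 2) + ((1 / 2) ^ (LP - j) * p + (1 / 2) ^ (j + 1) * p) := by
    intro j hj
    have hj := Finset.mem_range.1 hj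
    refine (measureReal_union_le _ _).trans (add_le_add ((measureReal_union_le _ _).trans
      (add_le_add ?_ ?_)) ((measureReal_union_le _ _).trans (add_le_add ?_ ?_)))
    · rw [measureReal_prod_prod, bitLaw_extend_pair_le p (by omega) (by omega) (by omega)]
      simp
    · rw [measureReal_prod_prod, bitLaw_extend_pair_le p (by omega) (by omega) (by omega)]
      simp
    · rw [measureReal_prod_prod, bitLaw_extend p (by omega)]
      gcongr
      exact bitLaw_run_right_le (by omega)
    · rw [measureReal_prod_prod, bitLaw_extend p (by omega)]
      gcongr
      exact bitLaw_run_left_le ha (by omega)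
  refine (Finset.sum_le_sum hle).trans ?_
  rw [Finset.sum_add_distrib, Finset.sum_add_distrib, Finset.sum_add_distrib, ← Finset.sum_mul, ← Finset.sum_mul,
    Finset.sum_const, Finset.card_range, nsmul_eq_mul]
  have h1 : ∑ j ∈ Finset.range LP, (1 / 2 : ℝ) ^ (LP - j) ≤ 1 := by
    rw [← Finset.sum_range_reflect]
    refine le_trans (le_of_eq (Finset.sum_congr rfl fun j hj => ?_)) (sum_half_pow_le LP)
    have := Finset.mem_range.1 hj
    congr 1
    omega
  have h2 := sum_half_pow_le LP
  nlinarith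

/-- A layer in which a path may have a vertex other than an incorrect match of a pivot with at most
one deletion. -/
def IsUsable (LS LP : ℕ) (X D : Fin n → Bool) (i : ℕ) : Prop :=
  windowDeletions D (pivotStart LS LP i) (pivotStart LS LP i + LP) = 0 ∨ IsNear LS LP X D i ∨
    2 ≤ windowDeletions D (pivotStart LS LP i) (pivotStart LS LP i + LP)

lemma bitLaw₂_snd (p q : unitInterval) (s : Set (Fin n → Bool)) :
    (bitLaw₂ (Fin n) p q).real {z | z.2 ∈ s} = (bitLaw (Fin n) q).real s := by
  have : {z : (Fin n → Bool) × (Fin n → Bool) | z.2 ∈ s} = Set.univ ×ˢ s := by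
    ext z
    simp
  rw [this, measureReal_prod_prod]
  simp

/-- No deletion contributes 1 − L_P β to first order and `IsNear` contributes 2β, together `rate`;
everything else, including double deletions, is of order (L_P β)². -/
lemma bitLaw₂_isUsable_le (p : unitInterval) {LS LP i : ℕ} (ha : 1 ≤ pivotStart LS LP i)
    (hn : pivotStart LS LP i + LP < n) (hLP : (LP : ℝ) * p ≤ 1) (hLP1 : 1 ≤ LP) :
    (bitLaw₂ (Fin n) oneHalf p).real {z | IsUsable LS LP z.1 z.2 i}
      ≤ rate LP p + 4 * LP ^ 2 * (p : ℝ) ^ 2 := by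
  have hp0 : (0 : ℝ) ≤ p := p.2.1
  have hp1 : (p : ℝ) ≤ 1 := p.2.2
  have h1 := bitLaw_window_zero p hn.le
  have h2 := bitLaw_two_le_window p hn.le
  rw [← bitLaw₂_snd oneHalf] at h1 h2
  have h3 := bitLaw₂_isNear_le p ha hn
  have h4 : (1 - (p : ℝ)) ^ LP ≤ 1 - LP * p + (LP * p) ^ 2 := by
    calc (1 - (p : ℝ)) ^ LP ≤ (Real.exp (-p)) ^ LP :=
          pow_le_pow_left₀ (by linarith) (Real.one_sub_le_exp_neg _) _
      _ = Real.exp (-(LP * p)) := by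
          rw [← Real.exp_nat_mul]
          congr 1
          ring
      _ ≤ _ := by
          have h0 : 0 ≤ (LP : ℝ) * p := by positivity
          have := Real.abs_exp_sub_one_sub_id_le (x := -(LP * p : ℝ))
            (by rwa [abs_neg, abs_of_nonneg h0])
          have := le_abs_self (Real.exp (-(LP * p : ℝ)) - 1 - -(LP * p : ℝ))
          nlinarith
  have hsub : {z : (Fin n → Bool) × (Fin n → Bool) | IsUsable LS LP z.1 z.2 i} ⊆
      {z | z.2 ∈ {D | windowDeletions D (pivotStart LS LP i) (pivotStart LS LP i + LP) = 0}} ∪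
        ({z | IsNear LS LP z.1 z.2 i} ∪
        {z | z.2 ∈ {D | 2 ≤ windowDeletions D (pivotStart LS LP i) (pivotStart LS LP i + LP)}}) :=
    fun z hz => hz
  have h5 := (measureReal_mono (μ := bitLaw₂ (Fin n) oneHalf p) hsub).trans
    ((measureReal_union_le _ _).trans (add_le_add le_rfl (measureReal_union_le _ _)))
  have h6 : (LP : ℝ) * (p : ℝ) ^ 2 ≤ LP ^ 2 * (p : ℝ) ^ 2 := by
    gcongr
    exact_mod_cast Nat.le_self_pow (by norm_num) LP
  unfold rate
  nlinarith

/-- The positions of the pivot `P_i` and its two neighbours. -/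
def pivotBlock (n LS LP i : ℕ) : Finset (Fin n) :=
  Finset.univ.filter fun j => pivotStart LS LP i ≤ j.val + 1 ∧ j.val ≤ pivotStart LS LP i + LP

/-- Each block takes one bit from the segment on either side, hence segments of length at least 2.
-/
lemma pivotBlock_disjoint {LS LP i j : ℕ} (hLS : 2 ≤ LS) (hi : 1 ≤ i) (hij : i < j) :
    Disjoint (pivotBlock n LS LP i) (pivotBlock n LS LP j) := by
  rw [Finset.disjoint_left]
  intro q hq hq'
  simp only [pivotBlock, Finset.mem_filter, Finset.mem_univ, true_and] at hq hq'
  have := pivotStart_add_le (LS := LS) (LP := LP) hi hij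
  omega

lemma pairwiseDisjoint_pivotBlock {LS LP k : ℕ} (hLS : 2 ≤ LS) :
    ((Finset.Ico 1 k : Finset ℕ) : Set ℕ).PairwiseDisjoint (pivotBlock n LS LP) := by
  intro i hi j hj hij
  rw [Finset.mem_coe, Finset.mem_Ico] at hi hj
  rcases lt_or_gt_of_ne hij with h | h
  · exact pivotBlock_disjoint hLS hi.1 h
  · exact (pivotBlock_disjoint hLS hj.1 h).symm

lemma extend_congr {LS LP i : ℕ} {Z Z' : Fin n → Bool} (h : ∀ j ∈ pivotBlock n LS LP i, Z j = Z' j)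
    {q : ℕ} (h1 : pivotStart LS LP i ≤ q + 1) (h2 : q ≤ pivotStart LS LP i + LP) :
    extend Z q = extend Z' q := by
  unfold extend
  split_ifs with hq
  · exact h ⟨q, hq⟩ (by simp [pivotBlock, h1, h2])
  · rfl

lemma windowDeletions_congr {LS LP i : ℕ} {D D' : Fin n → Bool}
    (h : ∀ j ∈ pivotBlock n LS LP i, D j = D' j) :
    windowDeletions D (pivotStart LS LP i) (pivotStart LS LP i + LP)
      = windowDeletions D' (pivotStart LS LP i) (pivotStart LS LP i + LP) := by
  unfold windowDeletions
  congr 1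
  refine Finset.filter_congr fun q hq => ?_
  rw [Finset.mem_Ico] at hq
  rw [extend_congr h (by omega) (by omega)]

lemma IsNear.congr {LS LP i : ℕ} {X X' D D' : Fin n → Bool}
    (hX : ∀ j ∈ pivotBlock n LS LP i, X j = X' j) (hD : ∀ j ∈ pivotBlock n LS LP i, D j = D' j)
    (h : IsNear LS LP X D i) : IsNear LS LP X' D' i := by
  obtain ⟨j, hj, h1, h2⟩ := h
  refine ⟨j, hj, ?_, ?_⟩
  · rw [← h1]
    exact (extend_congr hD (by omega) (by omega)).symm
  · refine h2.imp (fun h => ?_) (Or.imp (fun h => ?_) (Or.imp (fun h r hr hr' => ?_) fun h r hr => ?_))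
    · rw [← h]
      exact (extend_congr hD (by omega) (by omega)).symm
    · rw [← h]
      exact (extend_congr hD (by omega) (by omega)).symm
    · rw [← extend_congr hX (by omega) (by omega), ← extend_congr hX (by omega) (by omega)]
      exact h r hr hr'
    · rw [← extend_congr hX (by omega) (by omega), ← extend_congr hX (by omega) (by omega)]
      exact h r hr

lemma IsUsable.congr {LS LP i : ℕ} {X X' D D' : Fin n → Bool}
    (hX : ∀ j ∈ pivotBlock n LS LP i, X j = X' j) (hD : ∀ j ∈ pivotBlock n LS LP i, D j = D' j)
    (h : IsUsable LS LP X D i) : IsUsable LS LP X' D' i := by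
  unfold IsUsable at *
  rw [← windowDeletions_congr hD]
  exact h.imp id (Or.imp (fun h => h.congr hX hD) id)

end Probabilities

/-! ### Encoding the incorrect matches on a path by words

A word has one letter for each of the layers `1, …, k - 1`. -/

/-- The letters of a word: `free` for a layer outside the runs of incorrect matches, `anchor` for
the correct match before such a run, `skip` for a layer without a vertex before an incorrect match,
and `bad o` for an incorrect match with offset `o`. -/
inductive Letter : Type
  | free : Letter
  | anchor (h : Bool) : Letter
  | skip (h : Bool) : Letter
  | bad (o : ℕ) : Letter

/-- The states of the automaton that reads words: outside a run, at the beginning of a run, and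
after an incorrect match. -/
inductive Phase : Type
  | free : Phase
  | seek : Phase
  | run : Phase

/-- The words that the automaton accepts from a given state, with offsets below `M`. -/
def Accepted (M : ℕ) : Phase → List Letter → Prop
  | .free, [] => True
  | .seek, [] => False
  | .run, [] => True
  | .free, .free :: w => Accepted M .free w
  | .free, .anchor _ :: w => Accepted M .seek w
  | .free, _ :: _ => False
  | .seek, .skip _ :: w => Accepted M .seek w
  | .seek, .bad o :: w => o < M ∧ Accepted M .run w
  | .seek, _ :: _ => False
  | .run, .free :: w => Accepted M .free w
  | .run, .anchor _ :: w => Accepted M .seek w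
  | .run, .skip _ :: w => Accepted M .run w
  | .run, .bad o :: w => o < M ∧ Accepted M .run w

/-- The sum of `f` over all accepted words of a given length. -/
noncomputable def wordSum (M : ℕ) : ℕ → Phase → (List Letter → ℝ) → ℝ
  | 0, .free, f => f []
  | 0, .seek, _ => 0
  | 0, .run, f => f []
  | L + 1, .free, f => wordSum M L .free (fun w => f (.free :: w)) +
      ∑ h : Bool, wordSum M L .seek (fun w => f (.anchor h :: w))
  | L + 1, .seek, f => ∑ h : Bool, wordSum M L .seek (fun w => f (.skip h :: w)) +
      ∑ o ∈ Finset.range M, wordSum M L .run (fun w => f (.bad o :: w))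
  | L + 1, .run, f => (wordSum M L .free (fun w => f (.free :: w)) +
      ∑ h : Bool, wordSum M L .seek (fun w => f (.anchor h :: w))) +
      (∑ h : Bool, wordSum M L .run (fun w => f (.skip h :: w)) +
      ∑ o ∈ Finset.range M, wordSum M L .run (fun w => f (.bad o :: w)))

lemma wordSum_mono (M : ℕ) : ∀ (L : ℕ) (σ : Phase) {f g : List Letter → ℝ}, (∀ w, f w ≤ g w) →
    wordSum M L σ f ≤ wordSum M L σ g
  | 0, .free, _, _, h => h []
  | 0, .seek, _, _, _ => le_rfl
  | 0, .run, _, _, h => h []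
  | L + 1, .free, _, _, h => add_le_add (wordSum_mono M L _ fun _ => h _)
      (Finset.sum_le_sum fun _ _ => wordSum_mono M L _ fun _ => h _)
  | L + 1, .seek, _, _, h => add_le_add (Finset.sum_le_sum fun _ _ => wordSum_mono M L _ fun _ => h _)
      (Finset.sum_le_sum fun _ _ => wordSum_mono M L _ fun _ => h _)
  | L + 1, .run, _, _, h => add_le_add (add_le_add (wordSum_mono M L _ fun _ => h _)
      (Finset.sum_le_sum fun _ _ => wordSum_mono M L _ fun _ => h _))
      (add_le_add (Finset.sum_le_sum fun _ _ => wordSum_mono M L _ fun _ => h _)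
      (Finset.sum_le_sum fun _ _ => wordSum_mono M L _ fun _ => h _))

lemma wordSum_nonneg (M : ℕ) : ∀ (L : ℕ) (σ : Phase) {f : List Letter → ℝ}, (∀ w, 0 ≤ f w) →
    0 ≤ wordSum M L σ f
  | 0, .free, _, h => h []
  | 0, .seek, _, _ => le_rfl
  | 0, .run, _, h => h []
  | L + 1, .free, _, h => add_nonneg (wordSum_nonneg M L _ fun _ => h _)
      (Finset.sum_nonneg fun _ _ => wordSum_nonneg M L _ fun _ => h _)
  | L + 1, .seek, _, h => add_nonneg (Finset.sum_nonneg fun _ _ => wordSum_nonneg M L _ fun _ => h _)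
      (Finset.sum_nonneg fun _ _ => wordSum_nonneg M L _ fun _ => h _)
  | L + 1, .run, _, h => add_nonneg (add_nonneg (wordSum_nonneg M L _ fun _ => h _)
      (Finset.sum_nonneg fun _ _ => wordSum_nonneg M L _ fun _ => h _))
      (add_nonneg (Finset.sum_nonneg fun _ _ => wordSum_nonneg M L _ fun _ => h _)
      (Finset.sum_nonneg fun _ _ => wordSum_nonneg M L _ fun _ => h _))

/-- The union bound: an accepted word is one summand among nonnegative ones. -/
lemma le_wordSum (M : ℕ) : ∀ (w : List Letter) (σ : Phase) {f : List Letter → ℝ}, (∀ w, 0 ≤ f w) →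
    Accepted M σ w → f w ≤ wordSum M w.length σ f := by
  intro w
  induction w with
  | nil =>
    intro σ f hf h
    cases σ
    · exact le_rfl
    · exact h.elim
    · exact le_rfl
  | cons a w ih =>
    intro σ f hf h
    have hB : ∀ (g : Bool → Letter) (τ : Phase) (b : Bool), Accepted M τ w →
        f (g b :: w) ≤ ∑ h : Bool, wordSum M w.length τ (fun w => f (g h :: w)) := fun g τ b hw =>
      (ih τ (f := fun w => f (g b :: w)) (fun _ => hf _) hw).trans
        (Finset.single_le_sum (f := fun h => wordSum M w.length τ (fun w => f (g h :: w)))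
          (fun _ _ => wordSum_nonneg M _ _ fun _ => hf _) (Finset.mem_univ b))
    have hO : ∀ o < M, Accepted M .run w → f (.bad o :: w) ≤
        ∑ o ∈ Finset.range M, wordSum M w.length .run (fun w => f (.bad o :: w)) := fun o ho hw =>
      (ih .run (f := fun w => f (.bad o :: w)) (fun _ => hf _) hw).trans
        (Finset.single_le_sum (f := fun o => wordSum M w.length .run (fun w => f (.bad o :: w)))
          (fun _ _ => wordSum_nonneg M _ _ fun _ => hf _) (Finset.mem_range.2 ho))
    have h0B : ∀ (g : Bool → Letter) (τ : Phase),
        0 ≤ ∑ h : Bool, wordSum M w.length τ (fun w => f (g h :: w)) := fun g τ =>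
      Finset.sum_nonneg fun _ _ => wordSum_nonneg M _ _ fun _ => hf _
    have h0O : 0 ≤ ∑ o ∈ Finset.range M, wordSum M w.length .run (fun w => f (.bad o :: w)) :=
      Finset.sum_nonneg fun _ _ => wordSum_nonneg M _ _ fun _ => hf _
    have h0F : 0 ≤ wordSum M w.length .free (fun w => f (.free :: w)) :=
      wordSum_nonneg M _ _ fun _ => hf _
    have h1 := h0B .anchor .seek
    have h2 := h0B .skip .seek
    have h3 := h0B .skip .run
    cases σ <;> cases a <;> simp only [Accepted] at h <;>
      simp only [List.length_cons, wordSum]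
    · have := ih .free (f := fun w => f (.free :: w)) (fun _ => hf _) h
      linarith
    · exact (hB .anchor .seek _ h).trans (by linarith)
    · exact (hB .skip .seek _ h).trans (by linarith)
    · have := hO _ h.1 h.2
      linarith
    · have := ih .free (f := fun w => f (.free :: w)) (fun _ => hf _) h
      linarith
    · exact (hB .anchor .seek _ h).trans (by linarith)
    · exact (hB .skip .run _ h).trans (by linarith)
    · have := hO _ h.1 h.2
      linarith

lemma integral_wordSum {Ω : Type*} [Finite Ω] [MeasurableSpace Ω] [MeasurableSingletonClass Ω]
    (μ : Measure Ω) [IsFiniteMeasure μ] (M L : ℕ) : ∀ (σ : Phase) (f : Ω → List Letter → ℝ),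
    ∫ ω, wordSum M L σ (f ω) ∂μ = wordSum M L σ fun w => ∫ ω, f ω w ∂μ := by
  have hi : ∀ f : Ω → ℝ, Integrable f μ := integrable_bits μ
  induction L with
  | zero =>
    intro σ f
    cases σ <;> simp [wordSum]
  | succ L ih =>
    intro σ f
    cases σ <;> simp only [wordSum]
    · rw [integral_add (hi _) (hi _), integral_finsetSum _ fun _ _ => hi _]
      simp only [ih _ fun ω w => f ω (_ :: w)]
    · rw [integral_add (hi _) (hi _), integral_finsetSum _ fun _ _ => hi _,
        integral_finsetSum _ fun _ _ => hi _]
      simp only [ih _ fun ω w => f ω (_ :: w)]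
    · rw [integral_add (hi _) (hi _), integral_add (hi _) (hi _), integral_add (hi _) (hi _),
        integral_finsetSum _ fun _ _ => hi _, integral_finsetSum _ fun _ _ => hi _,
        integral_finsetSum _ fun _ _ => hi _]
      simp only [ih _ fun ω w => f ω (_ :: w)]

lemma wordSum_const_mul (M L : ℕ) : ∀ (σ : Phase) (f : List Letter → ℝ) (c : ℝ),
    wordSum M L σ (fun w => c * f w) = c * wordSum M L σ f := by
  induction L with
  | zero =>
    intro σ f c
    cases σ <;> simp [wordSum]
  | succ L ih =>
    intro σ f c
    cases σ <;> simp only [wordSum, ih, ← Finset.mul_sum, mul_add]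

/-- The weight of a letter. -/
noncomputable def Letter.weight (c : ℝ) : Letter → ℝ
  | .free => 1
  | .anchor _ => 1
  | .skip _ => 1 / 4
  | .bad _ => c

/-- The weight of a word, the product of the weights of its letters. -/
noncomputable def wordWeight (c : ℝ) (w : List Letter) : ℝ := (w.map (Letter.weight c)).prod

lemma wordWeight_nonneg {c : ℝ} (hc : 0 ≤ c) (w : List Letter) : 0 ≤ wordWeight c w := by
  refine List.prod_nonneg fun x hx => ?_
  obtain ⟨a, -, rfl⟩ := List.mem_map.1 hx
  cases a <;> simp only [Letter.weight] <;> positivity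

/-- A subharmonic function of the automaton. -/
noncomputable def Phase.potential (b : ℝ) : Phase → ℝ
  | .free => 1
  | .seek => 6 * b
  | .run => 3

/-- One letter multiplies the potential by at most 1 + 12b. From `free` the factor is 1 + 2·6b; from
`seek` one gets 2·(1/4)·6b + 3b = 6b; from `run`, (1 + 12b) + 2·(1/4)·3 + 3b ≤ 3(1 + 12b). The two
kinds of `skip` weigh 1/2 together, so stretches of skips sum geometrically, and starting a run
costs a factor of order b since `seek` must reach a `bad`. -/
lemma wordSum_wordWeight_le {M : ℕ} {b c : ℝ} (hc : 0 ≤ c) (hMc : M * c ≤ b) (hb : b ≤ 1 / 30)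
    (L : ℕ) : ∀ σ : Phase, wordSum M L σ (wordWeight c) ≤ σ.potential b * (1 + 12 * b) ^ L := by
  have hb0 : 0 ≤ b := le_trans (by positivity) hMc
  induction L with
  | zero =>
    intro σ
    cases σ <;> simp [wordSum, wordWeight, Phase.potential, hb0]
  | succ L ih =>
    have hF := ih .free
    have hA := ih .seek
    have hR := ih .run
    simp only [Phase.potential] at hF hA hR
    have hX : 0 ≤ (1 + 12 * b) ^ L := by positivity
    have hcons : ∀ (a : Letter), (fun w => wordWeight c (a :: w))
        = fun w => a.weight c * wordWeight c w := fun a => by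
      funext w
      simp [wordWeight]
    have hR0 : 0 ≤ wordSum M L .run (wordWeight c) := wordSum_nonneg M _ _ (wordWeight_nonneg hc)
    have hbad : M * (c * wordSum M L .run (wordWeight c)) ≤ b * (3 * (1 + 12 * b) ^ L) := by
      rw [← mul_assoc]
      exact mul_le_mul hMc hR hR0 hb0
    intro σ
    rw [pow_succ]
    set Y := (1 + 12 * b) ^ L
    have hbY : 0 ≤ b * Y := by positivity
    have hbbY : 0 ≤ b * (b * Y) := by positivity
    have hbbY' : b * Y ≤ 1 / 30 * Y := by gcongr
    cases σ <;> simp only [wordSum, hcons, wordSum_const_mul, Letter.weight, Finset.sum_const,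
      Finset.card_univ, Fintype.card_bool, Finset.card_range, nsmul_eq_mul, Phase.potential,
      Nat.cast_ofNat, one_mul]
    · nlinarith
    · nlinarith
    · nlinarith

/-- The layers of the letters `skip` and `bad`, if the first letter belongs to layer `i`. -/
def interior : List Letter → ℕ → Finset ℕ
  | [], _ => ∅
  | .free :: w, i => interior w (i + 1)
  | .anchor _ :: w, i => interior w (i + 1)
  | .skip _ :: w, i => insert i (interior w (i + 1))
  | .bad _ :: w, i => insert i (interior w (i + 1))

lemma interior_subset (w : List Letter) : ∀ i, interior w i ⊆ Finset.Ico i (i + w.length) := by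
  induction w with
  | nil => simp [interior]
  | cons a w ih =>
    intro i
    have h1 : interior w (i + 1) ⊆ Finset.Ico i (i + (a :: w).length) := by
      refine (ih (i + 1)).trans fun j hj => ?_
      rw [Finset.mem_Ico] at *
      simp only [List.length_cons]
      omega
    have h2 : i ∈ Finset.Ico i (i + (a :: w).length) := by simp
    cases a <;> simp only [interior]
    · exact h1
    · exact h1
    · exact Finset.insert_subset h2 h1
    · exact Finset.insert_subset h2 h1

/-- The number of letters `bad`. -/
def badCount : List Letter → ℕ
  | [] => 0
  | .bad _ :: w => badCount w + 1
  | _ :: w => badCount w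

/-- The layer of a `bad` letter is also an interior layer, so this letter carries both factors:
hence `c / 4`. -/
lemma wordWeight_eq (c : ℝ) (w : List Letter) : ∀ i,
    c ^ badCount w * (1 / 4) ^ (interior w i).card = wordWeight (c / 4) w := by
  induction w with
  | nil => simp [wordWeight, badCount, interior]
  | cons a w ih =>
    intro i
    have hi : i ∉ interior w (i + 1) := fun h => by
      have := Finset.mem_Ico.1 (interior_subset w _ h)
      omega
    have hcons : wordWeight (c / 4) (a :: w) = a.weight (c / 4) * wordWeight (c / 4) w := by
      simp [wordWeight]
    rw [hcons, ← ih (i + 1)]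
    cases a <;> simp only [interior, badCount, Letter.weight, Finset.card_insert_of_notMem hi,
      pow_succ] <;> ring

/-! ### Positions encoded by a word, and the union bound over words -/

section Decode

variable {n : ℕ}

/-- The last index of a correct match of the pivot `P_i`. -/
def anchorLast (LS LP : ℕ) (D : Fin n → Bool) (i : ℕ) (h : Bool) : ℕ :=
  if h then indexMap D (pivotLast LS LP i) else indexMap D (pivotFirst LS LP i) + LP - 1

/-- The pairs (layer, first index) of the incorrect matches that a word encodes; the first letter
belongs to layer `i`, and offsets are counted from `p`. -/
def decode (LS LP : ℕ) (D : Fin n → Bool) : List Letter → ℕ → ℕ → List (ℕ × ℕ)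
  | [], _, _ => []
  | .free :: w, i, p => decode LS LP D w (i + 1) p
  | .anchor h :: w, i, _ => decode LS LP D w (i + 1) (anchorLast LS LP D i h)
  | .skip h :: w, i, p => decode LS LP D w (i + 1) (if h then p + (LS + LP) else p)
  | .bad o :: w, i, p => (i, p + o) :: decode LS LP D w (i + 1) (p + o + LP - 1)

lemma length_decode (LS LP : ℕ) (D : Fin n → Bool) (w : List Letter) : ∀ i p,
    (decode LS LP D w i p).length = badCount w := by
  induction w with
  | nil => intro i p; rfl
  | cons a w ih =>
    intro i p
    cases a <;> simp [decode, badCount, ih]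

/-- The number of deletion-free pivots among the layers of the letters `skip` and `bad`. -/
def cleanInterior (LS LP : ℕ) (D : Fin n → Bool) (w : List Letter) : Finset ℕ :=
  (interior w 1).filter fun i =>
    windowDeletions D (pivotStart LS LP i) (pivotStart LS LP i + LP) = 0

/-- Distinct pivots are independent, and each is deletion-free with probability at least 1 − L_P β ≥
7/8; a layer thus contributes at most 1 − (7/8)² = 15/64 < 1/4. -/
lemma integral_cleanInterior_le (p : unitInterval) {LS LP k : ℕ} (hLS : 2 ≤ LS)
    (hn : n = k * LS + (k - 1) * LP) (hp : (LP : ℝ) * p ≤ 1 / 8) {w : List Letter}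
    (hw : w.length ≤ k - 1) :
    ∫ D, (1 / 8 : ℝ) ^ (cleanInterior LS LP D w).card ∂bitLaw (Fin n) p
      ≤ (1 / 4) ^ (interior w 1).card := by
  have hsub : interior w 1 ⊆ Finset.Ico 1 k := by
    refine (interior_subset w 1).trans fun j hj => ?_
    rw [Finset.mem_Ico] at *
    omega
  set C : ℕ → Set (Fin n → Bool) := fun i =>
    {D | windowDeletions D (pivotStart LS LP i) (pivotStart LS LP i + LP) = 0}
  set f : ℕ → (Fin n → Bool) → ℝ := fun i D =>
    if windowDeletions D (pivotStart LS LP i) (pivotStart LS LP i + LP) = 0 then 1 / 8 else 1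
  have h1 : ∀ D, (1 / 8 : ℝ) ^ (cleanInterior LS LP D w).card = ∏ i ∈ interior w 1, f i D := by
    intro D
    simp only [f]
    rw [Finset.prod_ite]
    simp [cleanInterior]
  simp only [h1]
  rw [integral_prod_of_dependsOn p _ f (pivotBlock n LS LP)
    ((pairwiseDisjoint_pivotBlock hLS).subset hsub)]
  · refine (Finset.prod_le_prod (fun i _ => integral_nonneg fun D => ?_) (g := fun _ => 1 / 4)
      fun i hi => ?_).trans (by simp)
    · simp only [f, Pi.zero_apply]
      split_ifs <;> norm_num
    · have hi' := Finset.mem_Ico.1 (hsub hi)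
      have h2 := pivotStart_bounds (n := n) hi'.1 hi'.2 hn
      have h3 : ∀ D, f i D = 1 - 7 / 8 * (C i).indicator 1 D := by
        intro D
        by_cases h : windowDeletions D (pivotStart LS LP i) (pivotStart LS LP i + LP) = 0 <;>
          simp [f, C, h]
        norm_num
      simp only [h3]
      rw [integral_sub (integrable_bits _ _) (integrable_bits _ _), integral_const_mul,
        integral_indicator_one (measurableSet_bits _)]
      simp only [C]
      rw [bitLaw_window_zero p (by omega)]
      have h4 := one_add_mul_le_pow (a := -(p : ℝ)) (by linarith [p.2.2]) LP
      rw [← sub_eq_add_neg] at h4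
      simp only [integral_const, probReal_univ, smul_eq_mul, mul_one]
      linarith
  · intro i _ D D' h
    simp only [f]
    rw [windowDeletions_congr fun j hj => h j hj]

/-- The probability that the incorrect matches encoded by some accepted word exist, while few
deletion-free pivots are lost. -/
lemma bitLaw₂_exists_word_le (p : unitInterval) {LS LP k : ℕ} (hLS : 2 ≤ LS)
    (hn : n = k * LS + (k - 1) * LP) (hp : (LP : ℝ) * p ≤ 1 / 8) {b : ℝ} (hb : b ≤ 1 / 30)
    (hM : ((LS + LP + 2 : ℕ) : ℝ) * (64 * (1 / 2) ^ LP / 4) ≤ b) (t : ℝ) :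
    (bitLaw₂ (Fin n) oneHalf p).real {z | ∃ (w : List Letter) (σ : Phase), w.length = k - 1 ∧
      (σ = .free ∨ σ = .seek) ∧ Accepted (LS + LP + 2) σ w ∧
      IsDisplaced LS LP k z.2 (decode LS LP z.2 w 1 0) ∧
      (∀ q ∈ decode LS LP z.2 w 1 0, IsMatch LS LP z.1 z.2 q.1 q.2) ∧
      t + (cleanInterior LS LP z.2 w).card ≤ 2 * badCount w}
      ≤ (8 : ℝ) ^ (-t) * (2 * (1 + 12 * b) ^ k) := by
  classical
  -- The cost of one bad match: probability 2^(-L_P), times 8² from the weight 8^(2·bad − clean).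
  set c : ℝ := 64 * (1 / 2) ^ LP with hc
  have hc0 : 0 ≤ c := by positivity
  have hb0 : 0 ≤ b := le_trans (by positivity) hM
  set V : List Letter → (Fin n → Bool) → Set (Fin n → Bool) := fun w D =>
    {X | IsDisplaced LS LP k D (decode LS LP D w 1 0) ∧
      ∀ q ∈ decode LS LP D w 1 0, IsMatch LS LP X D q.1 q.2}
  set f : (Fin n → Bool) × (Fin n → Bool) → List Letter → ℝ := fun z w =>
    if w.length = k - 1 then (V w z.2).indicator 1 z.1 * (64 ^ badCount w *
      (1 / 8 : ℝ) ^ (cleanInterior LS LP z.2 w).card) else 0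
  have hf0 : ∀ z w, 0 ≤ f z w := fun z w => by
    simp only [f]
    split_ifs
    · refine mul_nonneg (Set.indicator_nonneg (fun _ _ => zero_le_one) _) (by positivity)
    · exact le_rfl
  have hfint : ∀ w, ∫ z, f z w ∂bitLaw₂ (Fin n) oneHalf p ≤ wordWeight (c / 4) w := by
    intro w
    by_cases hw : w.length = k - 1
    · simp only [f, if_pos hw]
      -- The decoded positions depend on `D` alone, so the bits of `X` are integrated out first.
      rw [integral_prod_symm _ (integrable_bits _ _)]
      simp only
      have h1 : ∀ D : Fin n → Bool, ∫ X, (V w D).indicator 1 X * (64 ^ badCount w *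
          (1 / 8 : ℝ) ^ (cleanInterior LS LP D w).card) ∂bitLaw (Fin n) oneHalf
          ≤ c ^ badCount w * (1 / 8 : ℝ) ^ (cleanInterior LS LP D w).card := by
        intro D
        rw [integral_mul_const, integral_indicator_one (measurableSet_bits _)]
        have h2 := bitLaw_matches_le hn D (decode LS LP D w 1 0)
        rw [length_decode] at h2
        have h3 : c ^ badCount w = (1 / 2) ^ (badCount w * LP) * 64 ^ badCount w := by
          rw [hc, mul_pow, ← pow_mul, mul_comm LP, mul_comm]
        rw [h3, mul_assoc]
        exact mul_le_mul_of_nonneg_right h2 (by positivity)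
      refine (integral_mono (integrable_bits _ _) (integrable_bits _ _) h1).trans ?_
      rw [integral_const_mul, ← wordWeight_eq c w 1]
      gcongr
      exact integral_cleanInterior_le p hLS hn hp hw.le
    · simp only [f, if_neg hw, integral_zero]
      exact wordWeight_nonneg (by positivity) w
  have hsum : ∀ σ : Phase, wordSum (LS + LP + 2) (k - 1) σ
      (fun w => ∫ z, f z w ∂bitLaw₂ (Fin n) oneHalf p) ≤ σ.potential b * (1 + 12 * b) ^ k := by
    intro σ
    refine (wordSum_mono _ _ _ hfint).trans
      ((wordSum_wordWeight_le (by positivity) hM hb _ σ).trans ?_)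
    have hpot : 0 ≤ σ.potential b := by cases σ <;> simp only [Phase.potential] <;> positivity
    gcongr
    · linarith
    · omega
  have h8 : (0 : ℝ) < (8 : ℝ) ^ (-t) := by positivity
  -- On the event the word in question has 8^(2·bad − clean − t) ≥ 1.
  calc _ ≤ ∫ z, (8 : ℝ) ^ (-t) * (wordSum (LS + LP + 2) (k - 1) .free (f z) +
        wordSum (LS + LP + 2) (k - 1) .seek (f z)) ∂bitLaw₂ (Fin n) oneHalf p := by
        refine real_le_integral _ _ _ (fun z => ?_) ?_
        · have h1 := wordSum_nonneg (LS + LP + 2) (k - 1) .free (hf0 z)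
          have h2 := wordSum_nonneg (LS + LP + 2) (k - 1) .seek (hf0 z)
          positivity
        · rintro z ⟨w, σ, hw, hσ, hacc, hdis, hmat, ht⟩
          have h1 := wordSum_nonneg (LS + LP + 2) (k - 1) .free (hf0 z)
          have h2 := wordSum_nonneg (LS + LP + 2) (k - 1) .seek (hf0 z)
          have h3 := le_wordSum _ w σ (hf0 z) hacc
          rw [hw] at h3
          have h4 : f z w ≤ wordSum (LS + LP + 2) (k - 1) .free (f z) +
              wordSum (LS + LP + 2) (k - 1) .seek (f z) := by
            rcases hσ with rfl | rfl <;> linarith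
          have h5 : f z w = 64 ^ badCount w * (1 / 8 : ℝ) ^ (cleanInterior LS LP z.2 w).card := by
            simp only [f, if_pos hw]
            rw [Set.indicator_of_mem (show z.1 ∈ V w z.2 from ⟨hdis, hmat⟩)]
            simp
          have h6 : (1 : ℝ) ≤ (8 : ℝ) ^ (-t) * f z w := by
            have h7 : f z w = (8 : ℝ) ^ (2 * (badCount w : ℝ) - (cleanInterior LS LP z.2 w).card) := by
              rw [h5, Real.rpow_sub (by norm_num), Real.rpow_mul (by norm_num), Real.rpow_natCast,
                Real.rpow_natCast, one_div, inv_pow]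
              norm_num [div_eq_mul_inv]
            rw [h7, ← Real.rpow_add (by norm_num)]
            exact Real.one_le_rpow (by norm_num) (by linarith)
          exact h6.trans (by gcongr)
    _ ≤ (8 : ℝ) ^ (-t) * (2 * (1 + 12 * b) ^ k) := by
        rw [integral_const_mul, integral_add (integrable_bits _ _) (integrable_bits _ _),
          integral_wordSum, integral_wordSum]
        have h1 := hsum .free
        have h2 := hsum .seek
        simp only [Phase.potential] at h1 h2
        have h3 : 6 * b * (1 + 12 * b) ^ k ≤ 1 * (1 + 12 * b) ^ k := by
          gcongr
          linarith
        gcongr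
        linarith

end Decode

/-! ### The word of a path -/

section Words

lemma Accepted.run_of_free {M : ℕ} : ∀ {w : List Letter}, Accepted M .free w → Accepted M .run w
  | [], _ => trivial
  | .free :: _, h => h
  | .anchor _ :: _, h => h

lemma Accepted.free_append {M : ℕ} {w : List Letter} (h : Accepted M .free w) (j : ℕ) :
    Accepted M .free (List.replicate j .free ++ w) := by
  induction j with
  | zero => exact h
  | succ j ih => exact ih

lemma Accepted.skip_append {M : ℕ} {σ : Phase} (hσ : σ = .seek ∨ σ = .run) {w : List Letter}
    (h : Accepted M σ w) (b : Bool) (j : ℕ) :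
    Accepted M σ (List.replicate j (.skip b) ++ w) := by
  induction j with
  | zero => exact h
  | succ j ih => rcases hσ with rfl | rfl <;> exact ih

variable {n : ℕ}

lemma decode_free_append (LS LP : ℕ) (D : Fin n → Bool) (w : List Letter) (j : ℕ) : ∀ i p,
    decode LS LP D (List.replicate j .free ++ w) i p = decode LS LP D w (i + j) p := by
  induction j with
  | zero => intro i p; rfl
  | succ j ih =>
    intro i p
    rw [List.replicate_succ, List.cons_append, decode, ih]
    congr 1
    omega

lemma decode_skip_append (LS LP : ℕ) (D : Fin n → Bool) (w : List Letter) (b : Bool) (j : ℕ) :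
    ∀ i p, decode LS LP D (List.replicate j (.skip b) ++ w) i p
      = decode LS LP D w (i + j) (if b then p + j * (LS + LP) else p) := by
  induction j with
  | zero => intro i p; simp
  | succ j ih =>
    intro i p
    rw [List.replicate_succ, List.cons_append, decode, ih]
    cases b
    · simp only [Bool.false_eq_true, if_false]
      congr 1
      omega
    · simp only [if_true]
      congr 1
      · omega
      · ring

lemma interior_free_append (w : List Letter) (j : ℕ) : ∀ i,
    interior (List.replicate j .free ++ w) i = interior w (i + j) := by
  induction j with
  | zero => intro i; rfl
  | succ j ih =>
    intro i
    rw [List.replicate_succ, List.cons_append, interior, ih]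
    congr 1
    omega

lemma mem_interior_append {l : ℕ} (w' : List Letter) : ∀ (w : List Letter) (i : ℕ),
    l ∈ interior (w ++ w') i → l < i + w.length ∨ l ∈ interior w' (i + w.length) := by
  intro w
  induction w with
  | nil => intro i h; exact Or.inr h
  | cons a w ih =>
    intro i h
    have h2 : l = i ∨ l ∈ interior (w ++ w') (i + 1) := by
      cases a <;> simp only [List.cons_append, interior, Finset.mem_insert] at h <;> tauto
    rw [List.length_cons]
    rcases h2 with rfl | h2
    · left; omega
    · rw [show i + (w.length + 1) = i + 1 + w.length by omega]
      exact ih _ h2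

/-- Division by `B` with quotient capped at the number `d` of skipped layers. The quotient is
spelled by the flags of the `skip` letters, so the number of offsets of a `bad` letter does not grow
with `d`. Already for `d = 0` all values up to `B + 1` occur, hence the range `B + 2`. -/
lemma exists_offset {B : ℕ} (d : ℕ) : ∀ {o : ℕ}, o ≤ (d + 1) * B + 1 →
    ∃ e ≤ d, ∃ o' < B + 2, e * B + o' = o := by
  induction d with
  | zero => exact fun {o} h => ⟨0, le_rfl, o, by omega, by simp⟩
  | succ d ih =>
    intro o h
    by_cases ho : o < B + 2
    · exact ⟨0, by omega, o, ho, by simp⟩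
    · obtain ⟨e, he, o', ho', heq⟩ := ih (o := o - B) (by
        have : (d + 1 + 1) * B = (d + 1) * B + B := by ring
        omega)
      exact ⟨e + 1, by omega, o', ho', by rw [add_mul]; omega⟩

end Words

/-! ### From a path to its word -/

section Paths

variable {LS LP k n : ℕ} {X D : Fin n → Bool}

namespace Vertex

/-- An incorrect match of a pivot with at most one deletion. -/
def IsBad : Vertex LS LP k X D → Prop
  | s => False
  | t => False
  | pivot i v _ _ => ¬ IsCorrectMatch LS LP X D i v ∧ pivotDeletions LS LP D i ≤ 1

/-- A match of a pivot with at least two deletions. -/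
def IsMulti : Vertex LS LP k X D → Prop
  | s => False
  | t => False
  | pivot i _ _ _ => 2 ≤ pivotDeletions LS LP D i

/-- A match of a pivot. -/
def IsPivot : Vertex LS LP k X D → Prop
  | s => False
  | t => False
  | pivot _ _ _ _ => True

/-- The transitive closure of the adjacency in the matching graph is contained in this relation. -/
def Follows (u v : Vertex LS LP k X D) : Prop :=
  u.layer < v.layer ∧ u.last ≤ v.first ∧
    v.first + LP ≤ u.last + 1 + (v.layer - u.layer) * (LS + LP)

lemma first_le_last (hLP : 1 ≤ LP) (u : Vertex LS LP k X D) : u.first ≤ u.last := by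
  cases u <;> simp only [first, last] <;> omega

lemma last_lt (hLP : 1 ≤ LP) (u : Vertex LS LP k X D) : u.last < u.first + LP := by
  cases u <;> simp only [first, last] <;> omega

lemma Follows.of_adj {u v : Vertex LS LP k X D} (h : (matchingGraph LS LP k X D).Adj u v) :
    u.Follows v := by
  obtain ⟨h1, h2, h3⟩ := h
  unfold dis at h2 h3
  obtain ⟨d, hd⟩ := Nat.exists_eq_add_of_lt h1
  refine ⟨h1, by omega, ?_⟩
  rw [hd] at h3 ⊢
  rw [show u.layer + d + 1 - u.layer = d + 1 by omega]
  zify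
  push_cast at h3
  nlinarith

/-- A match occupies `LP` places of `Y`; adding `LP` to the bound for an edge makes it additive over
layers. So vertices can be dropped from a path without losing the bound on offsets. -/
lemma Follows.trans (hLP : 1 ≤ LP) {u v w : Vertex LS LP k X D} (h : u.Follows v)
    (h' : v.Follows w) : u.Follows w := by
  obtain ⟨h1, h2, h3⟩ := h
  obtain ⟨h4, h5, h6⟩ := h'
  have h7 := v.first_le_last hLP
  have h8 := v.last_lt hLP
  refine ⟨h1.trans h4, h2.trans (h7.trans h5), ?_⟩
  have h9 : (w.layer - u.layer) * (LS + LP)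
      = (v.layer - u.layer) * (LS + LP) + (w.layer - v.layer) * (LS + LP) := by
    rw [← add_mul]
    congr 1
    omega
  omega

lemma isGood_or_isBad_or_isMulti {u : Vertex LS LP k X D} (h : u.IsPivot) :
    u.IsGood ∨ u.IsBad ∨ u.IsMulti := by
  cases u with
  | s => exact h.elim
  | t => exact h.elim
  | pivot i v hi hm =>
    simp only [IsGood, IsBad, IsMulti]
    by_cases h1 : IsCorrectMatch LS LP X D i v
    · exact Or.inl h1
    · rcases Nat.lt_or_ge (pivotDeletions LS LP D i) 2 with h2 | h2
      · exact Or.inr (Or.inl ⟨h1, by omega⟩)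
      · exact Or.inr (Or.inr h2)

lemma IsBad.not_isMulti {u : Vertex LS LP k X D} (h : u.IsBad) : ¬ u.IsMulti := by
  cases u with
  | s => exact h.elim
  | t => exact h.elim
  | pivot i v hi hm =>
    have := h.2
    simp only [IsMulti]
    omega

/-- Given `D`, a correct match can end in at most two places; the flag of `anchor` chooses between
them. -/
lemma IsGood.exists_anchorLast {u : Vertex LS LP k X D} (h : u.IsGood) :
    ∃ b, anchorLast LS LP D u.layer b = u.last := by
  cases u with
  | s => exact h.elim
  | t => exact h.elim
  | pivot i v hi hm =>
    obtain ⟨-, h⟩ := h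
    simp only [layer, last, anchorLast]
    have hF : v = indexMap D (pivotFirst LS LP i) →
        ∃ b : Bool, (if b = true then indexMap D (pivotLast LS LP i)
          else indexMap D (pivotFirst LS LP i) + LP - 1) = v + LP - 1 := fun h =>
      ⟨false, by simp [h]⟩
    rcases h with ⟨-, h⟩ | ⟨-, h | h⟩
    · exact hF h
    · exact hF h
    · exact ⟨true, by simp only [if_true]; omega⟩

end Vertex

open Vertex

open scoped Classical in
/-- The pairs (layer, first index) of the incorrect matches in a list of vertices. -/
noncomputable def badList (l : List (Vertex LS LP k X D)) : List (ℕ × ℕ) :=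
  (l.filter fun u => decide u.IsBad).map fun u => (u.layer, u.first)

lemma badList_cons_of_isBad {u : Vertex LS LP k X D} (h : u.IsBad) (l) :
    badList (u :: l) = (u.layer, u.first) :: badList l := by
  simp [badList, h]

lemma badList_cons_of_not_isBad {u : Vertex LS LP k X D} (h : ¬ u.IsBad) (l) :
    badList (u :: l) = badList l := by
  simp [badList, h]

/-- Induction from the end of the path; `w` covers the layers after `u`, and `σ` is the phase in
which `u` leaves the automaton. After a vertex that is not bad this is `seek` exactly when the next
vertex is bad. In phase `free` decoding must not depend on the reference point, because no `anchor`
has recorded where `u` ends. -/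
lemma exists_word (hLP : 1 ≤ LP) (mid : List (Vertex LS LP k X D)) :
    ∀ u : Vertex LS LP k X D, (∀ v ∈ mid, v.IsPivot ∧ ¬ v.IsMulti) →
      (u :: (mid ++ [.t])).Pairwise Follows →
      ∃ (w : List Letter) (σ : Phase), w.length + u.layer + 1 = k ∧
        (u.IsBad → σ = .run) ∧ (¬ u.IsBad → σ = .free ∨ σ = .seek) ∧
        Accepted (LS + LP + 2) σ w ∧
        (σ = .free → ∀ p, decode LS LP D w (u.layer + 1) p = badList mid) ∧
        (decode LS LP D w (u.layer + 1) u.last = badList mid) ∧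
        ∀ v ∈ mid, ¬ v.IsBad → v.layer ∉ interior w (u.layer + 1) := by
  induction mid with
  | nil =>
    intro u _ hch
    have hlt : u.layer < k := by
      have := (List.pairwise_cons.1 hch).1 .t (by simp)
      exact this.1
    have hacc : Accepted (LS + LP + 2) .free (List.replicate (k - u.layer - 1) .free) := by
      have h : Accepted (LS + LP + 2) .free [] := trivial
      simpa using h.free_append (k - u.layer - 1)
    have hdec : ∀ p, decode LS LP D (List.replicate (k - u.layer - 1) .free) (u.layer + 1) p
        = badList ([] : List (Vertex LS LP k X D)) := fun p => by
      have := decode_free_append LS LP D [] (k - u.layer - 1) (u.layer + 1) p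
      simpa [decode, badList] using this
    have hlen : (List.replicate (k - u.layer - 1) Letter.free).length + u.layer + 1 = k := by
      rw [List.length_replicate]
      omega
    by_cases hu : u.IsBad
    · exact ⟨_, .run, hlen, fun _ => rfl, fun h => absurd hu h, hacc.run_of_free,
        fun h => by simp at h, hdec _, by simp⟩
    · exact ⟨_, .free, hlen, fun h => absurd h hu, fun _ => Or.inl rfl, hacc, fun _ => hdec, hdec _,
        by simp⟩
  | cons v mid ih =>
    intro u hmid hch
    rw [List.cons_append, List.pairwise_cons] at hch
    obtain ⟨hu, hch⟩ := hch
    obtain ⟨w, σ, hlen, hrun, hfree, hacc, hdec, hdec', hint⟩ :=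
      ih v (fun v hv => hmid v (by simp [hv])) hch
    have huv : u.Follows v := hu v (by simp)
    have hlater : ∀ v' ∈ mid, v.layer < v'.layer := fun v' hv' =>
      ((List.pairwise_cons.1 hch).1 v' (by simp [hv'])).1
    obtain ⟨h1, h2, h3⟩ := huv
    obtain ⟨d, hd⟩ := Nat.exists_eq_add_of_lt h1
    have hvp := hmid v (by simp)
    by_cases hv : v.IsBad
    · obtain rfl := hrun hv
      have hsub : v.layer - u.layer = d + 1 := by omega
      rw [hsub] at h3
      obtain ⟨e, he, o, ho, heq⟩ := exists_offset (B := LS + LP) d (o := v.first - u.last) (by omega)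
      -- The `d` layers between `u` and the bad vertex `v` become skips, `e` of which advance the
      -- reference point by `LS + LP`.
      set x := List.replicate e (Letter.skip true) ++ List.replicate (d - e) (Letter.skip false)
      have hxlen : x.length = d := by
        simp only [x, List.length_append, List.length_replicate]
        omega
      have hlast : v.last = v.first + LP - 1 := by
        cases v with
        | s => exact hv.elim
        | t => exact hv.elim
        | pivot => rfl
      have hwdec : decode LS LP D (x ++ .bad o :: w) (u.layer + 1) u.last = badList (v :: mid) := by
        simp only [x, List.append_assoc]
        rw [decode_skip_append, decode_skip_append, decode, badList_cons_of_isBad hv]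
        simp only [if_true, Bool.false_eq_true, if_false]
        rw [show u.layer + 1 + e + (d - e) = v.layer by omega,
          show u.last + e * (LS + LP) + o = v.first by omega, ← hlast, hdec']
      have hwacc : ∀ σ, (σ = .seek ∨ σ = .run) →
          Accepted (LS + LP + 2) σ (x ++ .bad o :: w) := by
        intro σ hσ
        have h0 : Accepted (LS + LP + 2) σ (.bad o :: w) := by
          rcases hσ with rfl | rfl <;> exact ⟨ho, hacc⟩
        simp only [x, List.append_assoc]
        exact (h0.skip_append hσ _ _).skip_append hσ _ _
      have hwlen : (x ++ .bad o :: w).length + u.layer + 1 = k := by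
        rw [List.length_append, hxlen, List.length_cons]
        omega
      have hwint : ∀ v' ∈ v :: mid, ¬ v'.IsBad →
          v'.layer ∉ interior (x ++ .bad o :: w) (u.layer + 1) := by
        intro v' hv' hb hmem
        rcases List.mem_cons.1 hv' with rfl | hv'
        · exact hb hv
        · have hl := hlater v' hv'
          rcases mem_interior_append _ _ _ hmem with h | h
          · omega
          · rw [hxlen, show u.layer + 1 + d = v.layer by omega] at h
            simp only [interior, Finset.mem_insert] at h
            rcases h with h | h
            · omega
            · exact hint v' hv' hb h
      by_cases hub : u.IsBad
      · exact ⟨_, .run, hwlen, fun _ => rfl, fun h => absurd hub h, hwacc _ (Or.inr rfl),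
          fun h => by simp at h, hwdec, hwint⟩
      · exact ⟨_, .seek, hwlen, fun h => absurd h hub, fun _ => Or.inr rfl, hwacc _ (Or.inl rfl),
          fun h => by simp at h, hwdec, hwint⟩
    · have hgood : v.IsGood := by
        rcases isGood_or_isBad_or_isMulti hvp.1 with h | h | h
        · exact h
        · exact absurd h hv
        · exact absurd h hvp.2
      -- The position of a correct match is recorded only if the next vertex is bad.
      obtain ⟨a, ha1, ha2, ha3⟩ : ∃ a : Letter, Accepted (LS + LP + 2) .free (a :: w) ∧
          (∀ p, decode LS LP D (a :: w) v.layer p = badList mid) ∧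
          interior (a :: w) v.layer = interior w (v.layer + 1) := by
        rcases hfree hv with rfl | rfl
        · exact ⟨.free, hacc, fun p => hdec rfl p, rfl⟩
        · obtain ⟨b, hb⟩ := hgood.exists_anchorLast
          refine ⟨.anchor b, hacc, fun p => ?_, rfl⟩
          rw [decode, hb, hdec']
      have hwacc := ha1.free_append d
      have hwdec : ∀ p, decode LS LP D (List.replicate d .free ++ a :: w) (u.layer + 1) p
          = badList (v :: mid) := fun p => by
        rw [decode_free_append, show u.layer + 1 + d = v.layer by omega, ha2,
          badList_cons_of_not_isBad hv]
      have hwlen : (List.replicate d Letter.free ++ a :: w).length + u.layer + 1 = k := by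
        rw [List.length_append, List.length_replicate, List.length_cons]
        omega
      have hwint : ∀ v' ∈ v :: mid, ¬ v'.IsBad →
          v'.layer ∉ interior (List.replicate d .free ++ a :: w) (u.layer + 1) := by
        intro v' hv' hb
        rw [interior_free_append, show u.layer + 1 + d = v.layer by omega, ha3]
        rcases List.mem_cons.1 hv' with rfl | hv'
        · intro h
          have := Finset.mem_Ico.1 (interior_subset w _ h)
          omega
        · exact hint v' hv' hb
      by_cases hub : u.IsBad
      · exact ⟨_, .run, hwlen, fun _ => rfl, fun h => absurd hub h, hwacc.run_of_free,
          fun h => by simp at h, hwdec _, hwint⟩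
      · exact ⟨_, .free, hwlen, fun h => absurd h hub, fun _ => Or.inl rfl, hwacc,
          fun _ => hwdec, hwdec _, hwint⟩

lemma IsSTPath.exists_mid {Q : List (Vertex LS LP k X D)} (hLP : 1 ≤ LP) (h : IsSTPath Q) :
    ∃ mid, Q = .s :: (mid ++ [.t]) ∧ Q.Pairwise Follows ∧ ∀ v ∈ mid, v.IsPivot := by
  obtain ⟨h1, h2, h3⟩ := h
  have : Trans (Follows (LS := LS) (LP := LP) (k := k) (X := X) (D := D)) Follows Follows :=
    ⟨fun h h' => h.trans hLP h'⟩
  have hpw : Q.Pairwise Follows :=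
    List.isChain_iff_pairwise.1 (h3.imp fun _ _ h => Follows.of_adj h)
  obtain ⟨rest, rfl⟩ : ∃ rest, Q = .s :: rest := by
    cases Q with
    | nil => simp at h1
    | cons a l => exact ⟨l, by simpa using h1⟩
  have hne : rest ≠ [] := by
    rintro rfl
    simp at h2
  have hlast : rest.getLast? = some .t := by
    rw [List.getLast?_cons_of_ne_nil hne] at h2
    exact h2
  obtain ⟨mid, rfl⟩ := List.getLast?_eq_some_iff.1 hlast
  refine ⟨mid, rfl, hpw, fun v hv => ?_⟩
  rw [List.pairwise_cons] at hpw
  have h4 := (hpw.1 v (by simp [hv])).1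
  have h5 := ((List.pairwise_append.1 hpw.2).2.2 v hv .t (by simp)).1
  cases v with
  | s => simp [layer] at h4
  | t => simp at h5
  | pivot => trivial

lemma Vertex.IsBad.displaced (hn : n = k * LS + (k - 1) * LP) {u : Vertex LS LP k X D} (h : u.IsBad) :
    IsMatch LS LP X D u.layer u.first ∧ (1 ≤ u.layer ∧ u.layer < k) ∧ ∀ r < LP,
      indexMap D (pivotStart LS LP u.layer + r + 1) ≠ u.first + r := by
  cases u with
  | s => exact h.elim
  | t => exact h.elim
  | pivot i v hi hm =>
    refine ⟨hm, hi, fun r hr heq => h.1 ?_⟩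
    have := pivotStart_bounds hi.1 hi.2 hn
    exact isCorrectMatch_of_indexMap_eq hi.1 (by omega) hr hm h.2 heq

lemma isDisplaced_badList (hn : n = k * LS + (k - 1) * LP) {l : List (Vertex LS LP k X D)}
    (hl : l.Pairwise Follows) : IsDisplaced LS LP k D (badList l) := by
  classical
  constructor
  · unfold badList
    rw [List.pairwise_map]
    refine List.Pairwise.imp_of_mem ?_ (hl.filter _)
    intro u v hu _ huv
    have hu : u.IsBad := by simpa using (List.mem_filter.1 hu).2
    refine ⟨huv.1, ?_⟩
    have h2 := huv.2.1
    cases u with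
    | s => exact hu.elim
    | t => exact hu.elim
    | pivot i v' hi hm =>
      simp only [last, first] at *
      omega
  · intro p hp
    unfold badList at hp
    obtain ⟨u, hu, rfl⟩ := List.mem_map.1 hp
    have hu : u.IsBad := by simpa using (List.mem_filter.1 hu).2
    have h := IsBad.displaced hn hu
    exact ⟨h.2.1, fun r hr _ => h.2.2 r hr⟩

open scoped Classical in
/-- The combinatorial content of the theorem: a path gives a word that encodes its incorrect
matches. -/
lemma IsSTPath.exists_word (hLP : 1 ≤ LP) (hLS : 1 ≤ LS) (hn : n = k * LS + (k - 1) * LP)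
    {Q : List (Vertex LS LP k X D)} (hQ : IsSTPath Q) :
    ∃ (w : List Letter) (σ : Phase), w.length = k - 1 ∧ (σ = .free ∨ σ = .seek) ∧
      Accepted (LS + LP + 2) σ w ∧ IsDisplaced LS LP k D (decode LS LP D w 1 0) ∧
      (∀ q ∈ decode LS LP D w 1 0, IsMatch LS LP X D q.1 q.2) ∧
      (cleanInterior LS LP D w).card + Q.length ≤
        ((Finset.Ico 1 k).filter fun i => IsUsable LS LP X D i).card + badCount w + 2 ∧
      Q.length ≤ goodCount Q + ((Finset.Ico 1 k).filter fun i =>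
        2 ≤ windowDeletions D (pivotStart LS LP i) (pivotStart LS LP i + LP)).card +
          badCount w + 2 := by
  obtain ⟨mid, hQeq, hpw, hpiv⟩ := hQ.exists_mid hLP
  set U := (Finset.Ico 1 k).filter fun i => IsUsable LS LP X D i
  set T := (Finset.Ico 1 k).filter fun i =>
    2 ≤ windowDeletions D (pivotStart LS LP i) (pivotStart LS LP i + LP)
  -- Matches of pivots with several deletions need be neither displaced nor at places known from
  -- `D`, so they are left out of the word; their layers count as skipped or free.
  set mid' := mid.filter fun u => decide ¬ u.IsMulti
  have hsubl : List.Sublist (.s :: (mid' ++ [.t])) (.s :: (mid ++ [.t])) :=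
    (List.filter_sublist.append_right _).cons_cons _
  have hpw' : (Vertex.s :: (mid' ++ [Vertex.t]) : List (Vertex LS LP k X D)).Pairwise Follows := by
    rw [hQeq] at hpw
    exact hpw.sublist hsubl
  have hmid' : ∀ v ∈ mid', v.IsPivot ∧ ¬ v.IsMulti := fun v hv => by
    obtain ⟨h1, h2⟩ := List.mem_filter.1 hv
    exact ⟨hpiv v h1, by simpa using h2⟩
  obtain ⟨w, σ, hlen, -, hσ, hacc, -, hdec, hint⟩ :=
    PivotMatching.exists_word hLP mid' .s hmid' hpw'
  simp only [layer, last, zero_add] at hlen hdec hint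
  have hpmid : mid.Pairwise Follows := by
    rw [hQeq] at hpw
    exact (List.pairwise_append.1 (List.pairwise_cons.1 hpw).2).1
  have hpmid' : mid'.Pairwise Follows := hpmid.filter _
  have hbad : badCount w = (mid.filter fun u => decide u.IsBad).length := by
    rw [← length_decode LS LP D w 1 0, hdec, badList, List.length_map]
    simp only [mid']
    rw [List.filter_filter]
    congr 1
    refine List.filter_congr fun u _ => ?_
    by_cases h : u.IsBad
    · simp [h, h.not_isMulti]
    · simp [h]
  have hQlen : Q.length = mid.length + 2 := by simp [hQeq]
  have hlayer : ∀ v : Vertex LS LP k X D, v.IsPivot → v.layer ∈ Finset.Ico 1 k := by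
    intro v hv
    cases v with
    | s => exact hv.elim
    | t => exact hv.elim
    | pivot i v hi hm => simpa [layer] using hi
  have hmultiL : ∀ v : Vertex LS LP k X D, v.IsMulti →
      v.layer ∈ T := by
    intro v hv
    cases v with
    | s => exact hv.elim
    | t => exact hv.elim
    | pivot i v hi hm =>
      simp only [IsMulti, pivotDeletions_eq hi.1] at hv
      exact Finset.mem_filter.2 ⟨by simpa [layer] using hi, hv⟩
  have hcard : ∀ l : List (Vertex LS LP k X D), l.Pairwise Follows →
      ((l.map layer).toFinset).card = l.length := by
    intro l hl
    rw [List.toFinset_card_of_nodup, List.length_map]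
    exact List.pairwise_map.2 (hl.imp fun h => h.1.ne)
  have hsplit : mid.length = (mid.filter fun u => decide u.IsBad).length +
      (mid.filter fun u => !decide u.IsBad).length :=
    List.length_eq_length_filter_add _
  refine ⟨w, σ, by omega, hσ fun h => h, hacc, ?_, ?_, ?_, ?_⟩
  · rw [hdec]
    exact isDisplaced_badList hn hpmid'
  · rw [hdec]
    intro q hq
    unfold badList at hq
    obtain ⟨u, hu, rfl⟩ := List.mem_map.1 hq
    have hu : u.IsBad := by simpa using (List.mem_filter.1 hu).2
    exact (IsBad.displaced hn hu).1
  · set N := ((mid.filter fun u => !decide u.IsBad).map layer).toFinset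
    have hN : N.card = (mid.filter fun u => !decide u.IsBad).length := hcard _ (hpmid.filter _)
    have hmemN : ∀ i ∈ N, ∃ v ∈ mid, ¬ v.IsBad ∧ v.layer = i := by
      intro i hi
      obtain ⟨v, hv, rfl⟩ := List.mem_map.1 (List.mem_toFinset.1 hi)
      obtain ⟨h1, h2⟩ := List.mem_filter.1 hv
      exact ⟨v, h1, by simpa using h2, rfl⟩
    -- Interior layers hold no correct match, and the layers dropped for multiple deletions are not
    -- deletion-free. Clean interior layers and layers of non-bad vertices thus compete for the
    -- usable layers.
    have hdisj : Disjoint (cleanInterior LS LP D w) N := by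
      rw [Finset.disjoint_left]
      intro i hi hiN
      obtain ⟨v, hv, hvb, rfl⟩ := hmemN i hiN
      obtain ⟨h1, h2⟩ := Finset.mem_filter.1 hi
      by_cases hvm : v.IsMulti
      · have := (Finset.mem_filter.1 (hmultiL v hvm)).2
        omega
      · exact hint v (List.mem_filter.2 ⟨hv, by simpa using hvm⟩) hvb h1
    have hsub : cleanInterior LS LP D w ∪ N ⊆ U := by
      refine Finset.union_subset (fun i hi => ?_) fun i hi => ?_
      · obtain ⟨h1, h2⟩ := Finset.mem_filter.1 hi
        have h3 := Finset.mem_Ico.1 (interior_subset w 1 h1)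
        exact Finset.mem_filter.2 ⟨Finset.mem_Ico.2 ⟨h3.1, by omega⟩, Or.inl h2⟩
      · obtain ⟨v, hv, hvb, rfl⟩ := hmemN i hi
        refine Finset.mem_filter.2 ⟨hlayer v (hpiv v hv), ?_⟩
        rcases isGood_or_isBad_or_isMulti (hpiv v hv) with h | h | h
        · cases v with
          | s => exact h.elim
          | t => exact h.elim
          | pivot i v hik hm =>
            have hb := pivotStart_bounds hik.1 hik.2 hn
            by_cases h0 : pivotDeletions LS LP D i = 0
            · left
              simpa [pivotDeletions_eq hik.1, layer] using h0
            · right; left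
              exact IsCorrectMatch.isNear hik.1 (by omega) (by omega) h h0
        · exact absurd h hvb
        · exact Or.inr (Or.inr (Finset.mem_filter.1 (hmultiL v h)).2)
    have := Finset.card_le_card hsub
    rw [Finset.card_union_of_disjoint hdisj] at this
    omega
  · have h1 : (mid.filter fun u => !decide u.IsBad).length ≤
        mid.countP (fun u => decide u.IsGood) + (mid.filter fun u => decide u.IsMulti).length := by
      rw [← List.countP_eq_length_filter, ← List.countP_eq_length_filter]
      have : ∀ l : List (Vertex LS LP k X D), (∀ v ∈ l, v.IsPivot) →
          l.countP (fun u => !decide u.IsBad) ≤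
            l.countP (fun u => decide u.IsGood) + l.countP (fun u => decide u.IsMulti) := by
        intro l
        induction l with
        | nil => simp
        | cons v l ih =>
          intro hl
          have h2 := ih fun v hv => hl v (by simp [hv])
          have h3 := isGood_or_isBad_or_isMulti (hl v (by simp))
          simp only [List.countP_cons]
          by_cases hb : v.IsBad <;> by_cases hg : v.IsGood <;> by_cases hm : v.IsMulti <;>
            simp only [hb, hg, hm, decide_true, decide_false, Bool.not_true, Bool.not_false,
              if_true, Bool.false_eq_true, if_false] <;> first | omega | tauto
      exact this mid hpiv
    have h2 : (mid.filter fun u => decide u.IsMulti).length ≤ T.card := by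
      rw [← hcard _ (hpmid.filter _)]
      refine Finset.card_le_card fun i hi => ?_
      obtain ⟨v, hv, rfl⟩ := List.mem_map.1 (List.mem_toFinset.1 hi)
      exact hmultiL v (by simpa using (List.mem_filter.1 hv).2)
    have h3 : mid.countP (fun u => decide u.IsGood) ≤ goodCount Q := by
      unfold goodCount
      rw [hQeq]
      exact List.Sublist.countP_le ((List.sublist_append_left _ _).cons _)
    omega

end Paths

/-! ### The main estimate -/

open scoped Classical in
/-- Outside of three unlikely events, every path of the right length has many good vertices. -/
lemma IsSTPath.le_goodCount {LS LP k n : ℕ} {X D : Fin n → Bool} (hLP : 1 ≤ LP) (hLS : 1 ≤ LS)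
    (hn : n = k * LS + (k - 1) * LP) {Q : List (Vertex LS LP k X D)} (hQ : IsSTPath Q)
    {R e a b t : ℝ} (hlen : |(Q.length : ℝ) - R| ≤ e)
    (hU : (((Finset.Ico 1 k).filter fun i => IsUsable LS LP X D i).card : ℝ) ≤ R + a)
    (hT : (((Finset.Ico 1 k).filter fun i =>
      2 ≤ windowDeletions D (pivotStart LS LP i) (pivotStart LS LP i + LP)).card : ℝ) ≤ b)
    (hE : ¬ ∃ (w : List Letter) (σ : Phase), w.length = k - 1 ∧
      (σ = .free ∨ σ = .seek) ∧ Accepted (LS + LP + 2) σ w ∧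
      IsDisplaced LS LP k D (decode LS LP D w 1 0) ∧
      (∀ q ∈ decode LS LP D w 1 0, IsMatch LS LP X D q.1 q.2) ∧
      t - e - a - 2 + (cleanInterior LS LP D w).card ≤ 2 * badCount w) :
    R - t - e - b - 2 ≤ goodCount Q := by
  obtain ⟨w, σ, h1, h2, h3, h4, h5, h6, h7⟩ := hQ.exists_word hLP hLS hn
  have h6' : ((cleanInterior LS LP D w).card : ℝ) + Q.length ≤
      ((Finset.Ico 1 k).filter fun i => IsUsable LS LP X D i).card + badCount w + 2 := by
    exact_mod_cast h6
  have h7' : (Q.length : ℝ) ≤ goodCount Q + ((Finset.Ico 1 k).filter fun i =>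
        2 ≤ windowDeletions D (pivotStart LS LP i) (pivotStart LS LP i + LP)).card +
          badCount w + 2 := by
    exact_mod_cast h7
  have h8 := (abs_le.1 hlen).1
  -- The layer count gives clean ≤ bad + e + a + 2. Adding t ≤ bad would give the event excluded by
  -- `hE`; this is the source of the factor 2 there.
  have h9 : (badCount w : ℝ) < t := by
    by_contra! h
    exact hE ⟨w, σ, h1, h2, h3, h4, h5, by linarith⟩
  linarith

/-- The square is a constant times (β^(1/2) log β)²·β, and β^(1/2) log β → 0. -/
lemma log_sq_isLittleO (C : ℝ) :
    (fun β : ℝ => (C * Real.logb 2 (1 / β) * β) ^ 2) =o[𝓝[>] 0] fun β : ℝ => β := by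
  have h1 := tendsto_log_mul_rpow_nhdsGT_zero (r := 1 / 2) (by norm_num)
  have h2 := ((h1.pow 2).const_mul ((C / Real.log 2) ^ 2))
  rw [zero_pow two_ne_zero, mul_zero] at h2
  have h3 := ((isLittleO_one_iff ℝ).2 h2).mul_isBigO (isBigO_refl (fun β : ℝ => β) (𝓝[>] 0))
  simp only [one_mul] at h3
  refine h3.congr' ?_ EventuallyEq.rfl
  filter_upwards [self_mem_nhdsWithin] with β hβ
  have hβ : (0 : ℝ) < β := hβ
  have h4 : (β ^ (1 / 2 : ℝ)) ^ 2 = β := by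
    rw [← Real.rpow_natCast, ← Real.rpow_mul hβ.le]
    norm_num
  rw [mul_pow, h4, Real.logb, one_div, Real.log_inv]
  ring

open scoped Classical in
lemma bitLaw₂_usable_count_le {n : ℕ} (β : unitInterval) {LS LP k : ℕ} (hLS : 2 ≤ LS) (hLP : 11 ≤ LP)
    (hn : n = k * LS + (k - 1) * LP) (hLPx : (LP : ℝ) * β ≤ 1 / 8) :
    (bitLaw₂ (Fin n) oneHalf β).real {z | (rate LP β + 4 * ((LP : ℝ) * β) ^ 2 + (β : ℝ) ^ 2) * k <
      (((Finset.Ico 1 k).filter fun i => IsUsable LS LP z.1 z.2 i).card : ℝ)}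
      ≤ Real.exp (-((β : ℝ) ^ 4 / 4 * k)) := by
  have hx0 : 0 ≤ (β : ℝ) := β.2.1
  have hx1 : (β : ℝ) ^ 2 ≤ 1 := pow_le_one₀ hx0 β.2.2
  have hLP' : (11 : ℝ) ≤ LP := by exact_mod_cast hLP
  have hLPx0 : 0 ≤ (LP : ℝ) * β := by positivity
  rw [show (β : ℝ) ^ 4 / 4 * k = ((β : ℝ) ^ 2) ^ 2 / 4 * k by ring]
  refine bitLaw₂_count_le oneHalf β (Finset.Ico 1 k) (fun i => {z | IsUsable LS LP z.1 z.2 i})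
    (pivotBlock n LS LP) (pairwiseDisjoint_pivotBlock hLS)
    (fun i _ X X' D D' hX hD h => IsUsable.congr hX hD h) ?_ ?_ (sq_nonneg _) hx1 ?_ fun i hi => ?_
  · unfold rate
    nlinarith [sq_nonneg ((LP : ℝ) * β)]
  · unfold rate
    nlinarith
  · rw [Nat.card_Ico]
    exact_mod_cast Nat.sub_le k 1
  · rw [Finset.mem_Ico] at hi
    have h := pivotStart_bounds hi.1 hi.2 hn
    refine (bitLaw₂_isUsable_le β (by omega) (by omega) (by linarith) (by omega)).trans (le_of_eq ?_)
    ring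

open scoped Classical in
lemma bitLaw₂_multi_count_le {n : ℕ} (β : unitInterval) {LS LP k : ℕ} (hLS : 2 ≤ LS)
    (hn : n = k * LS + (k - 1) * LP) (hLPx : (LP : ℝ) * β ≤ 1 / 8) :
    (bitLaw₂ (Fin n) oneHalf β).real {z | (((LP : ℝ) * β) ^ 2 + (β : ℝ) ^ 2) * k <
      (((Finset.Ico 1 k).filter fun i =>
        2 ≤ windowDeletions z.2 (pivotStart LS LP i) (pivotStart LS LP i + LP)).card : ℝ)}
      ≤ Real.exp (-((β : ℝ) ^ 4 / 4 * k)) := by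
  have hx0 : 0 ≤ (β : ℝ) := β.2.1
  have hx1 : (β : ℝ) ^ 2 ≤ 1 := pow_le_one₀ hx0 β.2.2
  have hLPx0 : 0 ≤ (LP : ℝ) * β := by positivity
  rw [show (β : ℝ) ^ 4 / 4 * k = ((β : ℝ) ^ 2) ^ 2 / 4 * k by ring]
  have key := bitLaw₂_count_le (κ := Fin n) oneHalf β (Finset.Ico 1 k)
    (fun i => {z | 2 ≤ windowDeletions z.2 (pivotStart LS LP i) (pivotStart LS LP i + LP)})
    (pivotBlock n LS LP) (pairwiseDisjoint_pivotBlock hLS) (fun i _ X X' D D' hX hD h => ?_)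
    (r := ((LP : ℝ) * β) ^ 2) (δ := (β : ℝ) ^ 2) (K := k)
    (sq_nonneg _) (by nlinarith) (sq_nonneg _) hx1 ?_ fun i hi => ?_
  · simp only [Set.mem_ofPred_eq] at key
    convert key
  · rw [Set.mem_ofPred_eq] at h ⊢
    rwa [← windowDeletions_congr hD]
  · rw [Nat.card_Ico]
    exact_mod_cast Nat.sub_le k 1
  · rw [Finset.mem_Ico] at hi
    have h := pivotStart_bounds hi.1 hi.2 hn
    have h1 := bitLaw_two_le_window (n := n) (a := pivotStart LS LP i) (LP := LP) β (by omega)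
    rw [← bitLaw₂_snd oneHalf] at h1
    exact h1.trans (le_of_eq (mul_pow _ _ _).symm)

/-- Since log 8 ≥ 2, the Markov factor is at most exp(−xk), while the sum over words contributes
only exp(3xk/16); the rest absorbs the Chernoff exponent x⁴/4. -/
lemma word_bound_le {x t : ℝ} (hx0 : 0 < x) (hx1 : x ≤ 1 / 8) {k : ℕ} (ht : x * k / 2 ≤ t) :
    (8 : ℝ) ^ (-t) * (2 * (1 + 12 * (x / 64)) ^ k) ≤ 2 * Real.exp (-(x ^ 4 / 4 * k)) := by
  have h3 : 0 ≤ x * k := by positivity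
  have h8 : (8 : ℝ) ^ (-t) ≤ Real.exp (-(x * k)) := by
    rw [Real.rpow_def_of_pos (by norm_num), Real.exp_le_exp]
    have h1 : 2 ≤ Real.log 8 := by
      have h2 : Real.log 8 = 3 * Real.log 2 := by
        rw [← Real.log_rpow (by norm_num)]
        norm_num
      linarith [Real.log_two_gt_d9]
    nlinarith
  have h9 : (1 + 12 * (x / 64)) ^ k ≤ Real.exp (k * (12 * (x / 64))) := by
    rw [Real.exp_nat_mul]
    gcongr
    linarith [Real.add_one_le_exp (12 * (x / 64))]
  calc (8 : ℝ) ^ (-t) * (2 * (1 + 12 * (x / 64)) ^ k)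
      ≤ Real.exp (-(x * k)) * (2 * Real.exp (k * (12 * (x / 64)))) := by gcongr
    _ = 2 * Real.exp (-(x * k) + k * (12 * (x / 64))) := by
      rw [Real.exp_add]
      ring
    _ ≤ 2 * Real.exp (-(x ^ 4 / 4 * k)) := by
      gcongr
      have h1 : x ^ 4 / 4 ≤ x / 2 := by
        have : x ^ 3 ≤ 1 := pow_le_one₀ hx0.le (by linarith)
        nlinarith
      have h2 : x ^ 4 / 4 * k ≤ x / 2 * k := by gcongr
      linarith

open scoped Classical in
/-- The bound for fixed parameters. -/
lemma channelLaw_goodCount {β : unitInterval} (hβ0 : 0 < (β : ℝ)) (hβ1 : (β : ℝ) ≤ 1 / 8)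
    {LS LP : ℕ} (hLS : |(LS : ℝ) - 1 / (β : ℝ)| < 1)
    (hLP : 11 + 2 * Real.logb 2 (1 / (β : ℝ)) ≤ LP) {e : ℝ}
    (he : |e| + 4 * ((LP : ℝ) * β) ^ 2 + 2 * (β : ℝ) ^ 2 ≤ β / 2) :
    ∃ c : ℝ, 0 < c ∧ ∃ N : ℕ, ∀ n k : ℕ, N ≤ n → n = k * LS + (k - 1) * LP → 1 ≤ k →
      1 - (2 : ℝ) ^ (-(c * n)) ≤ (channelLaw n β).real
          {XD | ∀ Q : List (Vertex LS LP k XD.1 XD.2), IsSTPath Q →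
            |(Q.length : ℝ) - rate LP β * k| ≤ e * k →
            rate LP β * k - β * k - (|e| + ((LP : ℝ) * β) ^ 2 + 2 * (β : ℝ) ^ 2) * k ≤
              (goodCount Q : ℝ)} := by
  set x : ℝ := (β : ℝ) with hx
  have hlog : 0 ≤ Real.logb 2 (1 / x) :=
    Real.logb_nonneg (by norm_num) (by rw [le_div_iff₀ hβ0]; linarith)
  have hLP11 : (11 : ℝ) ≤ LP := by linarith
  have hLP1 : 1 ≤ LP := by
    have : (1 : ℝ) ≤ LP := by linarith
    exact_mod_cast this
  have hxinv : 8 ≤ 1 / x := by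
    rw [le_div_iff₀ hβ0]
    linarith
  have hLSb := abs_lt.1 hLS
  have hLS2 : 2 ≤ LS := by
    have : (2 : ℝ) ≤ LS := by linarith
    exact_mod_cast this
  have hLPx0 : 0 ≤ (LP : ℝ) * x := by positivity
  have hLPx : (LP : ℝ) * x ≤ 1 / 8 := by
    have h1 : ((LP : ℝ) * x) ^ 2 ≤ (1 / 8) ^ 2 := by nlinarith [abs_nonneg e, sq_nonneg x]
    exact abs_le_of_sq_le_sq' h1 (by norm_num) |>.2
  -- The lower bound on L_P is tailored to this, with 2048 = 2^11. One factor x pays for the roughly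
  -- 1/x offsets, the other keeps bad matches rare.
  have hpow : (1 / 2 : ℝ) ^ LP ≤ x ^ 2 / 2048 := by
    have h1 : (2 : ℝ) ^ (11 + 2 * Real.logb 2 (1 / x)) ≤ (2 : ℝ) ^ (LP : ℝ) :=
      Real.rpow_le_rpow_of_exponent_le (by norm_num) hLP
    rw [Real.rpow_natCast, Real.rpow_add (by norm_num), mul_comm 2, Real.rpow_mul (by norm_num),
      Real.rpow_logb (by norm_num) (by norm_num) (by positivity)] at h1
    have h2 : (2048 : ℝ) * (1 / x) ^ 2 ≤ 2 ^ LP := by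
      refine le_trans (le_of_eq ?_) h1
      norm_num
    rw [one_div, inv_pow]
    have h3 := inv_anti₀ (by positivity) h2
    refine h3.trans (le_of_eq ?_)
    field_simp
  have hM : ((LS + LP + 2 : ℕ) : ℝ) * (64 * (1 / 2) ^ LP / 4) ≤ x / 64 := by
    have h1 : ((LS + LP + 2 : ℕ) : ℝ) ≤ 2 / x := by
      rw [le_div_iff₀ hβ0]
      push_cast
      have h2 : (LS : ℝ) * x ≤ (1 / x + 1) * x := by
        gcongr
        linarith
      rw [add_mul, one_div_mul_cancel hβ0.ne'] at h2
      nlinarith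
    calc ((LS + LP + 2 : ℕ) : ℝ) * (64 * (1 / 2) ^ LP / 4)
        ≤ 2 / x * (64 * (x ^ 2 / 2048) / 4) := by gcongr
      _ = x / 64 := by
        field_simp
        norm_num
  set B : ℝ := (LS : ℝ) + LP
  have hB : 0 < B := by positivity
  set a : ℝ := x ^ 4 / 4 with ha
  have ha0 : 0 < a := by positivity
  -- Here n ≤ kB. For n ≥ N one has ak ≥ 4, so half of the exponent absorbs the factor 4 of the
  -- union of events, and x²k ≥ 2, which absorbs the vertices `s` and `t`.
  refine ⟨a / (2 * B), by positivity, ⌈B * (4 / a + 2 / x ^ 2)⌉₊, fun n k hN hn hk => ?_⟩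
  have hnk : (n : ℝ) ≤ k * B := by
    have : n ≤ k * (LS + LP) := by
      rw [hn, mul_add]
      gcongr
      omega
    simp only [B]
    exact_mod_cast this
  have hk4 : 4 / a + 2 / x ^ 2 ≤ k := by
    have h1 : B * (4 / a + 2 / x ^ 2) ≤ n := (Nat.le_ceil _).trans (by exact_mod_cast hN)
    have h2 : (4 / a + 2 / x ^ 2) * B ≤ k * B := by linarith
    exact le_of_mul_le_mul_right h2 hB
  have hak : 4 ≤ a * k := by
    have h1 : 0 < 2 / x ^ 2 := by positivity
    have h2 : 4 / a ≤ k := by linarith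
    rwa [div_le_iff₀' ha0] at h2
  have hxk : 2 ≤ x ^ 2 * k := by
    have h1 : 0 < 4 / a := by positivity
    have h2 : 2 / x ^ 2 ≤ k := by linarith
    rwa [div_le_iff₀' (by positivity)] at h2
  set P := bitLaw₂ (Fin n) oneHalf β
  set u : ℝ := ((LP : ℝ) * x) ^ 2
  set E₁ : Set ((Fin n → Bool) × (Fin n → Bool)) := {z | (rate LP x + 4 * u + x ^ 2) * k <
    (((Finset.Ico 1 k).filter fun i => IsUsable LS LP z.1 z.2 i).card : ℝ)}
  set E₂ : Set ((Fin n → Bool) × (Fin n → Bool)) := {z | (u + x ^ 2) * k <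
    (((Finset.Ico 1 k).filter fun i =>
      2 ≤ windowDeletions z.2 (pivotStart LS LP i) (pivotStart LS LP i + LP)).card : ℝ)}
  -- The threshold of `IsSTPath.le_goodCount` when xk bad vertices are allowed; `he` and x²k ≥ 2
  -- keep it above xk/2.
  set t : ℝ := x * k - |e| * k - (4 * u + x ^ 2) * k - 2
  set E₃ : Set ((Fin n → Bool) × (Fin n → Bool)) := {z | ∃ (w : List Letter) (σ : Phase),
      w.length = k - 1 ∧ (σ = .free ∨ σ = .seek) ∧ Accepted (LS + LP + 2) σ w ∧
      IsDisplaced LS LP k z.2 (decode LS LP z.2 w 1 0) ∧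
      (∀ q ∈ decode LS LP z.2 w 1 0, IsMatch LS LP z.1 z.2 q.1 q.2) ∧
      t + (cleanInterior LS LP z.2 w).card ≤ 2 * badCount w}
  have hP₁ : P.real E₁ ≤ Real.exp (-(a * k)) :=
    bitLaw₂_usable_count_le β hLS2 (by exact_mod_cast hLP11) hn hLPx
  have hP₂ : P.real E₂ ≤ Real.exp (-(a * k)) := bitLaw₂_multi_count_le β hLS2 hn hLPx
  have hP₃ : P.real E₃ ≤ 2 * Real.exp (-(a * k)) := by
    refine (bitLaw₂_exists_word_le β hLS2 hn hLPx (b := x / 64) (by linarith) hM t).trans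
      (word_bound_le hβ0 hβ1 ?_)
    have : (|e| + 4 * u + 2 * x ^ 2) * k ≤ x / 2 * k := by gcongr
    simp only [t]
    linarith
  set G := {XD : (Fin n → Bool) × (Fin n → Bool) | ∀ Q : List (Vertex LS LP k XD.1 XD.2),
    IsSTPath Q → |(Q.length : ℝ) - rate LP x * k| ≤ e * k →
      rate LP x * k - x * k - (|e| + u + 2 * x ^ 2) * k ≤ (goodCount Q : ℝ)}
  have hsub : Gᶜ ⊆ (E₁ ∪ E₂) ∪ E₃ := by
    intro z hz
    by_contra hE
    simp only [Set.mem_union, not_or] at hE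
    obtain ⟨⟨h1, h2⟩, h3⟩ := hE
    refine hz fun Q hQ hlen => ?_
    have hek : e * k ≤ |e| * k := by
      gcongr
      exact le_abs_self e
    have h4 : (((Finset.Ico 1 k).filter fun i => IsUsable LS LP z.1 z.2 i).card : ℝ)
        ≤ (rate LP x + 4 * u + x ^ 2) * k := not_lt.1 h1
    have h5 : (((Finset.Ico 1 k).filter fun i =>
        2 ≤ windowDeletions z.2 (pivotStart LS LP i) (pivotStart LS LP i + LP)).card : ℝ)
        ≤ (u + x ^ 2) * k := not_lt.1 h2
    have := hQ.le_goodCount hLP1 (by omega) hn (t := x * k) (a := (4 * u + x ^ 2) * k)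
      (hlen.trans hek) (by refine le_trans h4 (le_of_eq ?_); ring) h5 h3
    linarith
  have hcompl : P.real Gᶜ ≤ 4 * Real.exp (-(a * k)) := by
    have h1 := (measureReal_mono (μ := P) hsub).trans ((measureReal_union_le _ _).trans
      (add_le_add (measureReal_union_le _ _) le_rfl))
    linarith
  rw [probReal_compl_eq_one_sub (measurableSet_bits G)] at hcompl
  have hfin : 4 * Real.exp (-(a * k)) ≤ (2 : ℝ) ^ (-(a / (2 * B) * n)) := by
    have h1 : Real.exp (-(a * k / 2)) ≤ (2 : ℝ) ^ (-(a / (2 * B) * n)) := by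
      rw [Real.rpow_def_of_pos (by norm_num), Real.exp_le_exp]
      have h2 : a / (2 * B) * n ≤ a / (2 * B) * (k * B) := by gcongr
      have h3 : a / (2 * B) * (k * B) = a * k / 2 := by field_simp
      have h4 : Real.log 2 ≤ 1 := by linarith [Real.log_two_lt_d9]
      have h5 : 0 ≤ a / (2 * B) * n := by positivity
      have h6 : 0 ≤ Real.log 2 := Real.log_nonneg (by norm_num)
      nlinarith
    refine le_trans ?_ h1
    have h2 : -(a * k) = -(a * k / 2) + -(a * k / 2) := by ring
    have h3 : Real.exp (-(a * k / 2)) ≤ Real.exp (-(1 + 1)) := by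
      rw [Real.exp_le_exp]
      linarith
    have h4 : 4 * Real.exp (-(1 + 1)) ≤ 1 := by
      rw [Real.exp_neg, Real.exp_add, ← div_eq_mul_inv, div_le_one (by positivity)]
      nlinarith [Real.add_one_le_exp (1 : ℝ)]
    rw [h2, Real.exp_add, ← mul_assoc]
    exact mul_le_of_le_one_left (Real.exp_nonneg _)
      ((mul_le_mul_of_nonneg_left h3 (by norm_num)).trans h4)
  change _ ≤ P.real G
  linarith

end PivotMatching

theorem theorem5 (C : ℝ) (ε₁ : ℝ → ℝ) (hε₁ : ε₁ =o[𝓝[>] 0] fun β : ℝ => β) :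
    ∃ ε₂ : ℝ → ℝ, (ε₂ =o[𝓝[>] 0] fun β : ℝ => β) ∧
    ∃ β₀ : ℝ, 0 < β₀ ∧ ∀ β : unitInterval, 0 < (β : ℝ) → (β : ℝ) < β₀ →
    ∀ LS LP : ℕ, |(LS : ℝ) - 1 / (β : ℝ)| < 1 →
      11 + 2 * Real.logb 2 (1 / (β : ℝ)) ≤ (LP : ℝ) →
      (LP : ℝ) ≤ C * Real.logb 2 (1 / (β : ℝ)) →
    ∃ c : ℝ, 0 < c ∧ ∃ N : ℕ, ∀ n k : ℕ, N ≤ n → n = k * LS + (k - 1) * LP → 1 ≤ k →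
      1 - (2 : ℝ) ^ (-(c * n)) ≤
        (PivotMatching.channelLaw n β).real
          {XD | ∀ Q : List (PivotMatching.Vertex LS LP k XD.1 XD.2), PivotMatching.IsSTPath Q →
            |(Q.length : ℝ) - PivotMatching.rate LP β * k| ≤ ε₁ β * k →
            PivotMatching.rate LP β * k - β * k - ε₂ β * k ≤
              (PivotMatching.goodCount Q : ℝ)} := by
  have hsq : (fun β : ℝ => β ^ 2) =o[𝓝[>] 0] fun β : ℝ => β := by
    have h := (isLittleO_pow_id (𝕜 := ℝ) one_lt_two).mono (nhdsWithin_le_nhds (s := Set.Ioi 0))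
    exact h
  have hlog := PivotMatching.log_sq_isLittleO C
  -- The case d = 1 is the choice of ε₂, and d = 4 is the smallness condition that determines β₀.
  -- The upper bound on L_P enters only through (L_P β)² ≤ (Cβ log(1/β))².
  have ho : ∀ d : ℝ, (fun β => |ε₁ β| + d * (C * Real.logb 2 (1 / β) * β) ^ 2 + 2 * β ^ 2)
      =o[𝓝[>] 0] fun β : ℝ => β := fun d =>
    (hε₁.abs_left.add (hlog.const_mul_left d)).add (hsq.const_mul_left 2)
  refine ⟨_, ho 1, ?_⟩
  have hev := (ho 4).bound (show (0 : ℝ) < 1 / 2 by norm_num)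
  obtain ⟨b₀, hb₀, hsub⟩ := mem_nhdsGT_iff_exists_Ioo_subset.1 hev
  refine ⟨min b₀ (1 / 8), lt_min hb₀ (by norm_num), fun β hβ0 hβ LS LP hLS hLP hLP' => ?_⟩
  have h1 : ‖|ε₁ β| + 4 * (C * Real.logb 2 (1 / (β : ℝ)) * β) ^ 2 + 2 * (β : ℝ) ^ 2‖
      ≤ 1 / 2 * ‖(β : ℝ)‖ := hsub ⟨hβ0, hβ.trans_le (min_le_left _ _)⟩
  rw [Real.norm_of_nonneg (by positivity), Real.norm_of_nonneg hβ0.le] at h1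
  have h2 : ((LP : ℝ) * β) ^ 2 ≤ (C * Real.logb 2 (1 / (β : ℝ)) * β) ^ 2 := by gcongr
  obtain ⟨c, hc, N, h⟩ := PivotMatching.channelLaw_goodCount hβ0
    (hβ.le.trans (min_le_right _ _)) hLS hLP (e := ε₁ β) (by linarith)
  refine ⟨c, hc, N, fun n k hN hn hk => (h n k hN hn hk).trans ?_⟩
  refine measureReal_mono (fun XD hXD Q hQ hlen => le_trans ?_ (hXD Q hQ hlen))
    (MeasureTheory.measure_ne_top (PivotMatching.bitLaw₂ (Fin n) PivotMatching.oneHalf β) _)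
  have h3 : (|ε₁ β| + ((LP : ℝ) * β) ^ 2 + 2 * (β : ℝ) ^ 2) * k ≤
      (|ε₁ β| + 1 * (C * Real.logb 2 (1 / (β : ℝ)) * β) ^ 2 + 2 * (β : ℝ) ^ 2) * k := by
    gcongr
    linarith
  linarith
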